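/- Let $M$ be a connected smooth $3$-dimensional manifold (without boundary, Hausdorff, second countable) with a contact metric structure $(\eta,\xi,\phi,g)$: $\eta$ is a smooth $1$-form such that $\eta\wedge d\eta$ is a volume form, $g$ is a smooth Riemannian metric, $\xi$ is a smooth $g$-unit vector field and $\phi$ is a smooth endomorphism field of $TM$ such that $$\eta(\xi)=1,\qquad \phi^2=-\mathrm{Id}+\eta\otimes\xi,\qquad \phi\xi=0,\qquad d\eta(X,Y)=2g(X,\phi Y),$$ where $d\eta(X,Y)=X(\eta(Y))-Y(\eta(X))-\eta([X,Y])$. Suppose that the structure is strict generalized Eta-Einstein, that is, the Ricci operator $Q$ of $g$ (given by $g(QX,Y)=\mathrm{Ric}(X,Y)$) satisfies $$QX=\lambda X+\gamma\,\eta(X)\,\xi$$ for all tangent vectors $X$, with smooth functions $\lambda,\gamma\colon M\to\mathbb{R}$ that are not both constant. Then the structure is K-contact, that is, $\xi$ is an infinitesimal isometry: $L_\xi g=0$. -/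

import Mathlib

open Bundle FiberBundle
open scoped Manifold ContDiff

noncomputable section

section LeviCivita

variable {E : Type*} [NormedAddCommGroup E] [NormedSpace ℝ E] [FiniteDimensional ℝ E]
  {H : Type*} [TopologicalSpace H] {I : ModelWithCorners ℝ E H}
  {M : Type*} [TopologicalSpace M] [ChartedSpace H M] [IsManifold I ∞ M]
  (g : ContMDiffRiemannianMetric I ∞ E (fun x : M ↦ TangentSpace I x))

set_option linter.unusedSectionVars false in
theorem mdifferentiableAt_metric {x : M} {Y Z : Π x : M, TangentSpace I x}
    (hY : MDiffAt (T% Y) x) (hZ : MDiffAt (T% Z) x) :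
    MDiffAt (fun y ↦ g.inner y (Y y) (Z y)) x := by
  have : MDifferentiableAt I (I.prod 𝓘(ℝ))
      (fun m ↦ TotalSpace.mk' ℝ (E := Bundle.Trivial M ℝ) m (g.inner m (Y m) (Z m))) x := by
    apply MDifferentiableAt.clm_bundle_apply₂ (F₁ := E) (F₂ := E)
    · exact g.contMDiff.mdifferentiableAt (by simp)
    · exact hY
    · exact hZ
  simp only [mdifferentiableAt_totalSpace] at this
  exact this.2

/-- The right-hand side of the Koszul formula for `2 g(∇_X Y, Z)`. -/
def koszul (X Y Z : Π x : M, TangentSpace I x) (x : M) : ℝ :=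
  d% (fun y ↦ g.inner y (Y y) (Z y)) x (X x) + d% (fun y ↦ g.inner y (X y) (Z y)) x (Y x)
    - d% (fun y ↦ g.inner y (X y) (Y y)) x (Z x)
    + g.inner x (VectorField.mlieBracket I X Y x) (Z x)
    - g.inner x (VectorField.mlieBracket I X Z x) (Y x)
    - g.inner x (VectorField.mlieBracket I Y Z x) (X x)

theorem koszul_tensorial_left {x : M} {Y Z : Π x : M, TangentSpace I x}
    (hY : MDiffAt (T% Y) x) (hZ : MDiffAt (T% Z) x) :
    TensorialAt I E (fun X : Π x : M, TangentSpace I x ↦ koszul g X Y Z x) x where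
  smul {f X} hf hX := by
    simp [koszul, mvfderiv_fun_mul hf (mdifferentiableAt_metric g hX hZ),
      mvfderiv_fun_mul hf (mdifferentiableAt_metric g hX hY),
      VectorField.mlieBracket_smul_left hf hX]
    ring
  add hX hX' := by
    simp [koszul, mvfderiv_fun_add (mdifferentiableAt_metric g hX hZ)
      (mdifferentiableAt_metric g hX' hZ),
      mvfderiv_fun_add (mdifferentiableAt_metric g hX hY) (mdifferentiableAt_metric g hX' hY),
      VectorField.mlieBracket_add_left hX hX']
    ring

theorem koszul_tensorial_right {x : M} {X Y : Π x : M, TangentSpace I x}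
    (hX : MDiffAt (T% X) x) (hY : MDiffAt (T% Y) x) :
    TensorialAt I E (fun Z : Π x : M, TangentSpace I x ↦ koszul g X Y Z x) x where
  smul {f Z} hf hZ := by
    simp [koszul, mvfderiv_fun_mul hf (mdifferentiableAt_metric g hX hZ),
      mvfderiv_fun_mul hf (mdifferentiableAt_metric g hY hZ),
      VectorField.mlieBracket_smul_right hf hZ]
    rw [g.symm x (Z x) (X x), g.symm x (Z x) (Y x)]
    ring
  add hZ hZ' := by
    simp [koszul, mvfderiv_fun_add (mdifferentiableAt_metric g hX hZ)
      (mdifferentiableAt_metric g hX hZ'),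
      mvfderiv_fun_add (mdifferentiableAt_metric g hY hZ) (mdifferentiableAt_metric g hY hZ'),
      VectorField.mlieBracket_add_right hZ hZ']
    ring

theorem koszul_add {x : M} {X Y Y' Z : Π x : M, TangentSpace I x}
    (hX : MDiffAt (T% X) x) (hY : MDiffAt (T% Y) x) (hY' : MDiffAt (T% Y') x)
    (hZ : MDiffAt (T% Z) x) :
    koszul g X (Y + Y') Z x = koszul g X Y Z x + koszul g X Y' Z x := by
  simp [koszul, mvfderiv_fun_add (mdifferentiableAt_metric g hX hY)
    (mdifferentiableAt_metric g hX hY'),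
    mvfderiv_fun_add (mdifferentiableAt_metric g hY hZ) (mdifferentiableAt_metric g hY' hZ),
    VectorField.mlieBracket_add_left hY hY', VectorField.mlieBracket_add_right hY hY']
  ring

theorem koszul_smul {x : M} {X Y Z : Π x : M, TangentSpace I x} {f : M → ℝ}
    (hX : MDiffAt (T% X) x) (hY : MDiffAt (T% Y) x) (hf : MDiffAt f x)
    (hZ : MDiffAt (T% Z) x) :
    koszul g X (f • Y) Z x
      = f x * koszul g X Y Z x + 2 * (d% f x (X x) * g.inner x (Y x) (Z x)) := by
  simp [koszul, mvfderiv_fun_mul hf (mdifferentiableAt_metric g hX hY),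
    mvfderiv_fun_mul hf (mdifferentiableAt_metric g hY hZ),
    VectorField.mlieBracket_smul_left hf hY, VectorField.mlieBracket_smul_right hf hY]
  rw [g.symm x (Y x) (X x)]
  ring

set_option linter.unusedSectionVars false in
/-- The metric identifies `T_x M` with its dual. -/
theorem metric_riesz (x : M) (l : TangentSpace I x →L[ℝ] ℝ) :
    ∃ v : TangentSpace I x, ∀ w, g.inner x v w = l w := by
  have : FiniteDimensional ℝ (TangentSpace I x) := inferInstanceAs (FiniteDimensional ℝ E)
  let T : TangentSpace I x →ₗ[ℝ] Module.Dual ℝ (TangentSpace I x) :=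
    (ContinuousLinearMap.coeLM ℝ) ∘ₗ (g.inner x).toLinearMap
  have hT : Function.Injective T := by
    rw [injective_iff_map_eq_zero]
    intro v hv
    by_contra hne
    have h1 := g.pos x v hne
    have h2 : g.inner x v v = 0 := congr($hv v)
    linarith
  have hT' : Function.Surjective T :=
    (LinearMap.injective_iff_surjective_of_finrank_eq_finrank
      (Subspace.dual_finrank_eq).symm).1 hT
  obtain ⟨v, hv⟩ := hT' l.toLinearMap
  exact ⟨v, fun w ↦ congr($hv w)⟩

set_option linter.unusedSectionVars false in
theorem metric_ext {x : M} {v v' : TangentSpace I x}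
    (h : ∀ w, g.inner x v w = g.inner x v' w) : v = v' := by
  by_contra hne
  have h1 := g.pos x (v - v') (sub_ne_zero.2 hne)
  have h2 := h (v - v')
  simp only [map_sub, _root_.sub_apply] at h1 h2
  linarith

/-- Every Riemannian metric admits a torsion-free metric connection. -/
theorem exists_leviCivita :
    ∃ D : CovariantDerivative I E (fun x : M ↦ TangentSpace I x),
      (∀ {X Y : Π x : M, TangentSpace I x} {x : M}, MDiffAt (T% X) x → MDiffAt (T% Y) x →
        D Y x (X x) - D X x (Y x) = VectorField.mlieBracket I X Y x) ∧
      (∀ {X Y Z : Π x : M, TangentSpace I x} {x : M}, MDiffAt (T% X) x → MDiffAt (T% Y) x →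
        MDiffAt (T% Z) x → d% (fun y ↦ g.inner y (Y y) (Z y)) x (X x)
          = g.inner x (D Y x (X x)) (Z x) + g.inner x (Y x) (D Z x (X x))) := by
  have key : ∀ (Y : Π x : M, TangentSpace I x) (x : M),
      ∃ A : TangentSpace I x →L[ℝ] TangentSpace I x, MDiffAt (T% Y) x →
        ∀ X Z : Π x : M, TangentSpace I x, MDiffAt (T% X) x → MDiffAt (T% Z) x →
          2 * g.inner x (A (X x)) (Z x) = koszul g X Y Z x := by
    intro Y x
    by_cases hY : MDiffAt (T% Y) x
    · have : FiniteDimensional ℝ (TangentSpace I x) := inferInstanceAs (FiniteDimensional ℝ E)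
      have : T2Space (TangentSpace I x) := inferInstanceAs (T2Space E)
      let B : TangentSpace I x →L[ℝ] TangentSpace I x →L[ℝ] ℝ :=
        TensorialAt.mkHom₂ (I := I) (F := E) (F' := E)
          (fun X Z : Π x : M, TangentSpace I x ↦ koszul g X Y Z x) x
          (fun Z hZ ↦ koszul_tensorial_left g hY hZ) (fun X hX ↦ koszul_tensorial_right g hX hY)
      have hB : ∀ X Z : Π x : M, TangentSpace I x, MDiffAt (T% X) x → MDiffAt (T% Z) x →
          B (X x) (Z x) = koszul g X Y Z x := fun X Z hX hZ ↦
        TensorialAt.mkHom₂_apply (I := I) (F := E) (F' := E)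
          (Φ := fun X Z : Π x : M, TangentSpace I x ↦ koszul g X Y Z x)
          (fun Z hZ ↦ koszul_tensorial_left g hY hZ) (fun X hX ↦ koszul_tensorial_right g hX hY)
          hX hZ
      choose S hS using metric_riesz g x
      let A : TangentSpace I x →ₗ[ℝ] TangentSpace I x :=
        { toFun := fun u ↦ (1 / 2 : ℝ) • S (B u)
          map_add' := fun u v ↦ by
            apply metric_ext g
            intro w
            simp [hS]
            ring
          map_smul' := fun c u ↦ by
            apply metric_ext g
            intro w
            simp [hS]
            ring }
      refine ⟨LinearMap.toContinuousLinearMap A, fun _ X Z hX hZ ↦ ?_⟩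
      have : g.inner x ((1 / 2 : ℝ) • S (B (X x))) (Z x) = 1 / 2 * koszul g X Y Z x := by
        simp [hS, hB X Z hX hZ]
      calc 2 * g.inner x ((1 / 2 : ℝ) • S (B (X x))) (Z x) = _ := by rw [this]
        _ = _ := by ring
    · exact ⟨0, fun h ↦ absurd h hY⟩
  choose D hD using key
  have ext' : ∀ {x : M} {v v' : TangentSpace I x}, (∀ Z : Π x : M, TangentSpace I x,
      MDiffAt (T% Z) x → 2 * g.inner x v (Z x) = 2 * g.inner x v' (Z x)) → v = v' := by
    intro x v v' h
    apply metric_ext g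
    intro w
    have := h (extend E w) (mdifferentiableAt_extend ..)
    simpa using this
  refine ⟨⟨D, ⟨?_, ?_⟩⟩, ?_, ?_⟩
  · intro Y Y' x hY hY' _
    ext u
    apply ext'
    intro Z hZ
    have hU : MDiffAt (T% (extend E u : Π x : M, TangentSpace I x)) x :=
      mdifferentiableAt_extend ..
    have h1 := hD (Y + Y') x (mdifferentiableAt_add_section hY hY') _ Z hU hZ
    have h2 := hD Y x hY _ Z hU hZ
    have h3 := hD Y' x hY' _ Z hU hZ
    rw [koszul_add g hU hY hY' hZ] at h1
    simp only [extend_apply_self] at h1 h2 h3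
    simp only [_root_.add_apply, map_add]
    linarith
  · intro Y f x hY hf _
    ext u
    apply ext'
    intro Z hZ
    have hU : MDiffAt (T% (extend E u : Π x : M, TangentSpace I x)) x :=
      mdifferentiableAt_extend ..
    have h1 := hD (f • Y) x (hf.smul_section hY) _ Z hU hZ
    have h2 := hD Y x hY _ Z hU hZ
    rw [koszul_smul g hU hY hf hZ] at h1
    simp only [extend_apply_self] at h1 h2
    simp
    linear_combination (h1 - f x * h2) / 2
  · intro X Y x hX hY
    apply ext'
    intro Z hZ
    have h1 := hD Y x hY X Z hX hZ
    have h2 := hD X x hX Y Z hY hZ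
    simp only [koszul] at h1 h2
    rw [VectorField.mlieBracket_swap_apply (V := Y) (W := X)] at h2
    have h3 : (fun y ↦ g.inner y (X y) (Y y)) = (fun y ↦ g.inner y (Y y) (X y)) :=
      funext fun y ↦ g.symm y _ _
    rw [h3] at h1
    simp only [map_sub, map_neg, _root_.sub_apply, _root_.neg_apply] at h1 h2 ⊢
    linear_combination h1 - h2
  · intro X Y Z x hX hY hZ
    have h1 := hD Y x hY X Z hX hZ
    have h2 := hD Z x hZ X Y hX hY
    simp only [koszul] at h1 h2
    rw [VectorField.mlieBracket_swap_apply (V := Z) (W := Y)] at h2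
    have h3 : (fun y ↦ g.inner y (Z y) (Y y)) = (fun y ↦ g.inner y (Y y) (Z y)) :=
      funext fun y ↦ g.symm y _ _
    rw [h3] at h2
    rw [g.symm x (Y x)]
    simp only [map_neg, _root_.neg_apply] at h1 h2 ⊢
    linarith

/-- The Levi-Civita connection of `g`, that is, the torsion-free connection preserving `g`
(`leviCivita g Y x v` is `∇_v Y`). -/
def leviCivita : CovariantDerivative I E (fun x : M ↦ TangentSpace I x) :=
  (exists_leviCivita g).choose

theorem leviCivita_torsionFree {X Y : Π x : M, TangentSpace I x} {x : M}
    (hX : MDiffAt (T% X) x) (hY : MDiffAt (T% Y) x) :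
    leviCivita g Y x (X x) - leviCivita g X x (Y x) = VectorField.mlieBracket I X Y x :=
  (exists_leviCivita g).choose_spec.1 hX hY

theorem leviCivita_metric {X Y Z : Π x : M, TangentSpace I x} {x : M}
    (hX : MDiffAt (T% X) x) (hY : MDiffAt (T% Y) x) (hZ : MDiffAt (T% Z) x) :
    d% (fun y ↦ g.inner y (Y y) (Z y)) x (X x)
      = g.inner x (leviCivita g Y x (X x)) (Z x) + g.inner x (Y x) (leviCivita g Z x (X x)) :=
  (exists_leviCivita g).choose_spec.2 hX hY hZ

/-- The curvature `R(X,Y)Z = ∇_X ∇_Y Z - ∇_Y ∇_X Z - ∇_{[X,Y]} Z` on vector fields. -/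
def curvature (X Y Z : Π x : M, TangentSpace I x) (x : M) : TangentSpace I x :=
  leviCivita g (fun y ↦ leviCivita g Z y (Y y)) x (X x)
    - leviCivita g (fun y ↦ leviCivita g Z y (X y)) x (Y x)
    - leviCivita g Z x (VectorField.mlieBracket I X Y x)

/-- The curvature tensor at `x`: the tangent vectors are extended to vector fields that are
smooth near `x`; the value does not depend on the extensions. -/
def curvatureTensor (x : M) (u v w : TangentSpace I x) : TangentSpace I x :=
  curvature g (extend E u) (extend E v) (extend E w) x

theorem exists_orthonormal_basis (x : M) :
    ∃ b : Module.Basis (Fin (Module.finrank ℝ E)) ℝ (TangentSpace I x),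
      ∀ i j, g.inner x (b i) (b j) = if i = j then 1 else 0 := by
  let _ : RiemannianBundle (fun x : M ↦ TangentSpace I x) := ⟨g.toRiemannianMetric⟩
  have : FiniteDimensional ℝ (TangentSpace I x) := inferInstanceAs (FiniteDimensional ℝ E)
  let e : OrthonormalBasis (Fin (Module.finrank ℝ E)) ℝ (TangentSpace I x) :=
    stdOrthonormalBasis ℝ (TangentSpace I x)
  refine ⟨e.toBasis, fun i j ↦ ?_⟩
  rw [OrthonormalBasis.coe_toBasis]
  exact orthonormal_iff_ite.1 e.orthonormal i j

/-- A `g`-orthonormal basis of `T_x M`. -/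
def orthonormalBasisAt (x : M) :
    Module.Basis (Fin (Module.finrank ℝ E)) ℝ (TangentSpace I x) :=
  (exists_orthonormal_basis g x).choose

theorem orthonormalBasisAt_spec (x : M) (i j : Fin (Module.finrank ℝ E)) :
    g.inner x (orthonormalBasisAt g x i) (orthonormalBasisAt g x j) = if i = j then 1 else 0 :=
  (exists_orthonormal_basis g x).choose_spec i j

/-- The Ricci operator `Q u = ∑ᵢ R(u, eᵢ) eᵢ`, `(eᵢ)` orthonormal; thus
`g(Q u, w) = Ric(u, w)`. -/
def ricciOperator (x : M) (u : TangentSpace I x) : TangentSpace I x :=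
  ∑ i, curvatureTensor g x u (orthonormalBasisAt g x i) (orthonormalBasisAt g x i)

/-- `ξ` is an infinitesimal isometry: `L_ξ g = 0`, that is,
`ξ (g(X,Y)) = g([ξ,X],Y) + g(X,[ξ,Y])` for all smooth vector fields `X`, `Y`. -/
def IsInfinitesimalIsometry (ξ : Π x : M, TangentSpace I x) : Prop :=
  ∀ X Y : Π x : M, TangentSpace I x, CMDiff ∞ (T% X) → CMDiff ∞ (T% Y) → ∀ x : M,
    d% (fun y ↦ g.inner y (X y) (Y y)) x (ξ x)
      = g.inner x (VectorField.mlieBracket I ξ X x) (Y x)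
        + g.inner x (X x) (VectorField.mlieBracket I ξ Y x)

end LeviCivita

section ExteriorDerivative

variable {E : Type*} [NormedAddCommGroup E] [NormedSpace ℝ E]
  {H : Type*} [TopologicalSpace H] {I : ModelWithCorners ℝ E H}
  {M : Type*} [TopologicalSpace M] [ChartedSpace H M] [IsManifold I ∞ M]

/-- The exterior derivative of a one-form,
`dη(X,Y) = X(η(Y)) - Y(η(X)) - η([X,Y])`, where the tangent vectors `u`, `v` at `x` are extended
to vector fields that are smooth near `x`; the value does not depend on the extensions. -/
def extDerivOneForm (η : Π x : M, TangentSpace I x →L[ℝ] ℝ) (x : M) (u v : TangentSpace I x) : ℝ :=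
  d% (fun y ↦ η y (extend E v y)) x u - d% (fun y ↦ η y (extend E u y)) x v
    - η x (VectorField.mlieBracket I (extend E u) (extend E v) x)

end ExteriorDerivative

section Contact

/-- A contact metric structure `(η, ξ, φ, g)` on a 3-manifold `M`. -/
structure ContactMetricStructure (M : Type*) [TopologicalSpace M]
    [ChartedSpace (EuclideanSpace ℝ (Fin 3)) M] [IsManifold (𝓡 3) ∞ M] where
  /-- the Riemannian metric -/
  g : ContMDiffRiemannianMetric (𝓡 3) ∞ (EuclideanSpace ℝ (Fin 3))
    (fun x : M ↦ TangentSpace (𝓡 3) x)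
  /-- the contact form -/
  η : Π x : M, TangentSpace (𝓡 3) x →L[ℝ] ℝ
  /-- the Reeb field -/
  ξ : Π x : M, TangentSpace (𝓡 3) x
  /-- the endomorphism of the tangent bundle -/
  φ : Π x : M, TangentSpace (𝓡 3) x →L[ℝ] TangentSpace (𝓡 3) x
  smooth_η : ContMDiff (𝓡 3) ((𝓡 3).prod 𝓘(ℝ, EuclideanSpace ℝ (Fin 3) →L[ℝ] ℝ)) ∞
    (fun x ↦ TotalSpace.mk' (EuclideanSpace ℝ (Fin 3) →L[ℝ] ℝ)
      (E := fun x : M ↦ TangentSpace (𝓡 3) x →L[ℝ] ℝ) x (η x))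
  smooth_ξ : ContMDiff (𝓡 3) (𝓡 3).tangent ∞ (fun x ↦ (⟨x, ξ x⟩ : TangentBundle (𝓡 3) M))
  smooth_φ : ContMDiff (𝓡 3)
    ((𝓡 3).prod 𝓘(ℝ, EuclideanSpace ℝ (Fin 3) →L[ℝ] EuclideanSpace ℝ (Fin 3))) ∞
    (fun x ↦ TotalSpace.mk' (EuclideanSpace ℝ (Fin 3) →L[ℝ] EuclideanSpace ℝ (Fin 3))
      (E := fun x : M ↦ TangentSpace (𝓡 3) x →L[ℝ] TangentSpace (𝓡 3) x) x (φ x))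
  /-- `η ∧ dη` is a volume form -/
  contact : ∀ (x : M) (e : Fin 3 → TangentSpace (𝓡 3) x), LinearIndependent ℝ e →
    η x (e 0) * extDerivOneForm η x (e 1) (e 2) + η x (e 1) * extDerivOneForm η x (e 2) (e 0)
      + η x (e 2) * extDerivOneForm η x (e 0) (e 1) ≠ 0
  unit_ξ : ∀ x, g.inner x (ξ x) (ξ x) = 1
  η_ξ : ∀ x, η x (ξ x) = 1
  φ_sq : ∀ x u, φ x (φ x u) = -u + η x u • ξ x
  φ_ξ : ∀ x, φ x (ξ x) = 0
  dη_eq : ∀ x u v, extDerivOneForm η x u v = 2 * g.inner x u (φ x v)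

variable {M : Type*} [TopologicalSpace M] [ChartedSpace (EuclideanSpace ℝ (Fin 3)) M]
  [IsManifold (𝓡 3) ∞ M]

/-- The structure is K-contact: the Reeb field is an infinitesimal isometry. -/
def ContactMetricStructure.IsKContact (S : ContactMetricStructure M) : Prop :=
  IsInfinitesimalIsometry S.g S.ξ

/-- `Q X = α X + β η(X) ξ` with smooth functions `α` and `β`. -/
def ContactMetricStructure.IsGeneralizedEtaEinsteinWith (S : ContactMetricStructure M)
    (α β : M → ℝ) : Prop :=
  ContMDiff (𝓡 3) 𝓘(ℝ) ∞ α ∧ ContMDiff (𝓡 3) 𝓘(ℝ) ∞ β ∧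
    ∀ x u, ricciOperator S.g x u = α x • u + (β x * S.η x u) • S.ξ x

/-- Generalized Eta-Einstein, with coefficient functions that are not both constant. -/
def ContactMetricStructure.IsStrictGeneralizedEtaEinstein (S : ContactMetricStructure M) : Prop :=
  ∃ α β : M → ℝ, S.IsGeneralizedEtaEinsteinWith α β ∧
    ¬ ((∃ a, ∀ x, α x = a) ∧ (∃ b, ∀ x, β x = b))

end Contact

end

/-! Work in a local orthonormal frame `e 0 = X`, `e 1 = φ X`, `e 2 = ξ`. The contact metric
condition fixes the skew part of ∇ξ, and ξ is geodesic and divergence-free. So the symmetric part of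
∇ξ, the shear, is a traceless tensor on the contact planes with components ±s and 1 - t, where s and
t are the ξ-components of ∇_{e 0} e 0 and ∇_{e 0} e 1. K-contact means that the shear vanishes. The
remaining unknowns a, b, c are the values on the frame of the one-form ω = g(∇ e 0, e 1).

The Ricci condition and the Jacobi identity become a first-order system for a, b, c, s, t
(`structure_equations`). Ric(ξ, ξ) gives α + β = 2(1 - ρ) with ρ = s² + (t - 1)²; other components
say that the shear is parallel along ξ and has zero horizontal divergence. Commuting the derivative
along ξ past the horizontal ones gives an algebraic relation between the shear and its covariant
derivative (`shear_mul_deriv`). It makes ρ, hence α + β, locally constant (`dirDeriv_add_eq_zero`),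
and constant on M by connectedness (`add_eq_const`).

If α + β ≠ 2, then ρ ≠ 0 and the same relation makes the shear parallel. Its polar angle then turns
at the rate of 2ω, up to sign, so dω = 0. But dω(e 0, e 1) = -α, so α = 0 (`eq_zero_of_add_ne_two`)
and β is constant too, against strictness. Hence α + β = 2, the shear vanishes, and ∇ξ is skew
(`covDeriv_skew`), which is the Killing equation. -/

noncomputable section

/-! ### Smooth fields and functions on a set; directional derivatives -/

section SmoothOn

open VectorField Topology

set_option linter.unusedSectionVars false

variable {E : Type*} [NormedAddCommGroup E] [NormedSpace ℝ E] [FiniteDimensional ℝ E]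
  {H : Type*} [TopologicalSpace H] {I : ModelWithCorners ℝ E H}
  {M : Type*} [TopologicalSpace M] [ChartedSpace H M] [IsManifold I ∞ M]

/-- A vector field that is smooth at every point of `U`. -/
def SmoothFieldOn (U : Set M) (X : Π x : M, TangentSpace I x) : Prop :=
  ∀ y ∈ U, CMDiffAt ∞ (T% X) y

variable (I) in
/-- A function that is smooth at every point of `U`. -/
def SmoothFunOn (U : Set M) (f : M → ℝ) : Prop :=
  ∀ y ∈ U, CMDiffAt ∞ f y

/-- The covariant derivative `∇_X Y` of vector fields. -/
def covDeriv (g : ContMDiffRiemannianMetric I ∞ E (fun x : M ↦ TangentSpace I x))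
    (X Y : Π x : M, TangentSpace I x) (x : M) : TangentSpace I x :=
  leviCivita g Y x (X x)

/-- The derivative `X f` of a function along a vector field. -/
def dirDeriv (X : Π x : M, TangentSpace I x) (f : M → ℝ) (x : M) : ℝ := d% f x (X x)

variable {g : ContMDiffRiemannianMetric I ∞ E (fun x : M ↦ TangentSpace I x)}
  {U : Set M} {X Y Z W : Π x : M, TangentSpace I x} {f f' : M → ℝ} {x : M}

theorem SmoothFieldOn.mdiffAt (h : SmoothFieldOn U X) (hx : x ∈ U) : MDiffAt (T% X) x :=
  (h x hx).mdifferentiableAt (by simp)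

theorem SmoothFunOn.mdiffAt (h : SmoothFunOn I U f) (hx : x ∈ U) : MDiffAt f x :=
  (h x hx).mdifferentiableAt (by simp)

theorem SmoothFieldOn.add (hX : SmoothFieldOn U X) (hY : SmoothFieldOn U Y) :
    SmoothFieldOn U (X + Y) := fun y hy ↦ (hX y hy).add_section (hY y hy)

theorem SmoothFieldOn.smul (hf : SmoothFunOn I U f) (hX : SmoothFieldOn U X) :
    SmoothFieldOn U (f • X) := fun y hy ↦ (hf y hy).smul_section (hX y hy)

theorem SmoothFieldOn.sum {ι : Type*} {s : Finset ι} {X : ι → Π x : M, TangentSpace I x}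
    (hX : ∀ i ∈ s, SmoothFieldOn U (X i)) : SmoothFieldOn U (∑ i ∈ s, X i) := fun y hy ↦ by
  simpa using ContMDiffAt.sum_section (fun i hi ↦ hX i hi y hy)

theorem SmoothFieldOn.congr (hU : IsOpen U) (hX : SmoothFieldOn U X) (h : ∀ y ∈ U, Y y = X y) :
    SmoothFieldOn U Y := fun y hy ↦ (hX y hy).congr_of_eventuallyEq <| by
  filter_upwards [hU.mem_nhds hy] with z hz
  rw [h z hz]

theorem SmoothFunOn.congr (hU : IsOpen U) (hf : SmoothFunOn I U f) (h : ∀ y ∈ U, f' y = f y) :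
    SmoothFunOn I U f' := fun y hy ↦ (hf y hy).congr_of_eventuallyEq <| by
  filter_upwards [hU.mem_nhds hy] with z hz
  rw [h z hz]

theorem SmoothFunOn.const (c : ℝ) : SmoothFunOn I U (fun _ ↦ c) := fun _ _ ↦ contMDiffAt_const

theorem SmoothFunOn.add (hf : SmoothFunOn I U f) (hf' : SmoothFunOn I U f') :
    SmoothFunOn I U (fun y ↦ f y + f' y) := fun y hy ↦ (hf y hy).add (hf' y hy)

theorem SmoothFunOn.sub (hf : SmoothFunOn I U f) (hf' : SmoothFunOn I U f') :
    SmoothFunOn I U (fun y ↦ f y - f' y) := fun y hy ↦ (hf y hy).sub (hf' y hy)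

theorem SmoothFunOn.mul (hf : SmoothFunOn I U f) (hf' : SmoothFunOn I U f') :
    SmoothFunOn I U (fun y ↦ f y * f' y) := fun y hy ↦ (hf y hy).mul (hf' y hy)

theorem SmoothFunOn.neg (hf : SmoothFunOn I U f) :
    SmoothFunOn I U (fun y ↦ - f y) := fun y hy ↦ (hf y hy).neg

theorem SmoothFunOn.const_mul (c : ℝ) (hf : SmoothFunOn I U f) :
    SmoothFunOn I U (fun y ↦ c * f y) := (SmoothFunOn.const c).mul hf

theorem SmoothFunOn.inner (g : ContMDiffRiemannianMetric I ∞ E (fun x : M ↦ TangentSpace I x))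
    (hX : SmoothFieldOn U X) (hY : SmoothFieldOn U Y) :
    SmoothFunOn I U (fun y ↦ g.inner y (X y) (Y y)) := fun y hy ↦ by
  have : ContMDiffAt I (I.prod 𝓘(ℝ)) ∞
      (fun m ↦ TotalSpace.mk' ℝ (E := Bundle.Trivial M ℝ) m (g.inner m (X m) (Y m))) y := by
    apply ContMDiffAt.clm_bundle_apply₂ (F₁ := E) (F₂ := E)
    · exact g.contMDiff.contMDiffAt
    · exact hX y hy
    · exact hY y hy
  simp only [contMDiffAt_totalSpace] at this
  exact this.2

theorem SmoothFieldOn.mlieBracket (hX : SmoothFieldOn U X) (hY : SmoothFieldOn U Y) :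
    SmoothFieldOn U (mlieBracket I X Y) := fun y hy ↦ by
  -- Since ∞ + 1 = ∞, the bracket of smooth fields loses no regularity.
  have : IsManifold I ((⊤ : ℕ∞) + 1) M := by
    convert! (inferInstance : IsManifold I ∞ M)
  have : IsManifold I (minSmoothness ℝ 2) M := by
    rw [minSmoothness_of_isRCLikeNormedField]
    infer_instance
  exact ContMDiffAt.mlieBracket_vectorField (n := ⊤) (m := ⊤) (hX y hy) (hY y hy)
    (by rw [minSmoothness_of_isRCLikeNormedField]; rfl)

theorem mlieBracket_congr (hU : IsOpen U) (h : ∀ y ∈ U, X y = Y y) (h' : ∀ y ∈ U, Z y = W y)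
    (hx : x ∈ U) : mlieBracket I X Z x = mlieBracket I Y W x :=
  Filter.EventuallyEq.mlieBracket_vectorField_eq
    (Filter.eventuallyEq_of_mem (hU.mem_nhds hx) h)
    (Filter.eventuallyEq_of_mem (hU.mem_nhds hx) h')

theorem dirDeriv_congr (hU : IsOpen U) (h : ∀ y ∈ U, f y = f' y) (hx : x ∈ U) :
    dirDeriv X f x = dirDeriv X f' x := by
  simp only [dirDeriv, mvfderiv]
  have h1 := (Filter.eventuallyEq_of_mem (hU.mem_nhds hx) h).mfderiv_eq (I := I) (I' := 𝓘(ℝ))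
  rw [h1, h x hx]

/-- `[X, f Z] = (X f) Z + f [X, Z]`. -/
theorem mlieBracket_smul_right' (hf : SmoothFunOn I U f) (hZ : SmoothFieldOn U Z) (hx : x ∈ U) :
    mlieBracket I X (f • Z) x = dirDeriv X f x • Z x + f x • mlieBracket I X Z x :=
  mlieBracket_smul_right (hf.mdiffAt hx) (hZ.mdiffAt hx)

/-- Pairing `[X, f Z] = (X f) Z + f [X, Z]` with a unit field `Z` expresses `X f` through brackets
and the metric, whose smoothness is already known. -/
theorem SmoothFunOn.dirDeriv (g : ContMDiffRiemannianMetric I ∞ E (fun x : M ↦ TangentSpace I x))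
    (hU : IsOpen U) (hZ : SmoothFieldOn U Z) (hZ1 : ∀ y ∈ U, g.inner y (Z y) (Z y) = 1)
    (hX : SmoothFieldOn U X) (hf : SmoothFunOn I U f) : SmoothFunOn I U (dirDeriv X f) := by
  refine ((SmoothFunOn.inner g (hX.mlieBracket (SmoothFieldOn.smul hf hZ)) hZ).sub
    (hf.mul (SmoothFunOn.inner g (hX.mlieBracket hZ) hZ))).congr hU fun y hy ↦ ?_
  rw [mlieBracket_smul_right' hf hZ hy]
  simp [hZ1 y hy]

/-- `X (Y f) - Y (X f) = [X, Y] f`. -/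
theorem dirDeriv_commutator (hU : IsOpen U) (hZ : SmoothFieldOn U Z)
    (hZ1 : ∀ y ∈ U, g.inner y (Z y) (Z y) = 1)
    (hX : SmoothFieldOn U X) (hY : SmoothFieldOn U Y) (hf : SmoothFunOn I U f) (hx : x ∈ U) :
    dirDeriv X (dirDeriv Y f) x - dirDeriv Y (dirDeriv X f) x
      = dirDeriv (mlieBracket I X Y) f x := by
  have : IsManifold I (minSmoothness ℝ 3) M := by
    rw [minSmoothness_of_isRCLikeNormedField]
    exact IsManifold.of_le (n := ∞) ENat.LEInfty.out
  have h2 : ∀ {V : Π x : M, TangentSpace I x}, SmoothFieldOn U V →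
      CMDiffAt (minSmoothness ℝ 2) (T% V) x := fun hV ↦ by
    rw [minSmoothness_of_isRCLikeNormedField]
    exact (hV x hx).of_le ENat.LEInfty.out
  have expand : ∀ {V V' : Π x : M, TangentSpace I x}, SmoothFieldOn U V → SmoothFieldOn U V' →
      mlieBracket I V (mlieBracket I V' (f • Z)) x
        = dirDeriv V (dirDeriv V' f) x • Z x + dirDeriv V' f x • mlieBracket I V Z x
          + dirDeriv V f x • mlieBracket I V' Z x
          + f x • mlieBracket I V (mlieBracket I V' Z) x := fun {V V'} hV hV' ↦ by
    have hd := SmoothFunOn.dirDeriv g hU hZ hZ1 hV' hf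
    rw [mlieBracket_congr hU (X := V) (Y := V) (fun _ _ ↦ rfl)
      (W := dirDeriv V' f • Z + f • mlieBracket I V' Z)
      (fun y hy ↦ mlieBracket_smul_right' hf hZ hy) hx,
      mlieBracket_add_right ((SmoothFieldOn.smul hd hZ).mdiffAt hx)
        ((SmoothFieldOn.smul hf (hV'.mlieBracket hZ)).mdiffAt hx),
      mlieBracket_smul_right' hd hZ hx, mlieBracket_smul_right' hf (hV'.mlieBracket hZ) hx]
    abel
  -- Jacobi for `X`, `Y`, `f Z`: the mixed first-order terms cancel, the terms in undifferentiated
  -- `f` cancel by Jacobi for `X`, `Y`, `Z`, and pairing with the unit field `Z` leaves the claim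
  -- about `f`.
  have h3 := leibniz_identity_mlieBracket_apply (h2 hX) (h2 hY)
    (h2 (SmoothFieldOn.smul hf hZ))
  rw [expand hX hY, expand hY hX, mlieBracket_smul_right' hf hZ hx,
    leibniz_identity_mlieBracket_apply (h2 hX) (h2 hY) (h2 hZ)] at h3
  have h4 := congr(g.inner x $h3 (Z x))
  simp [hZ1 x hx] at h4
  linear_combination h4

theorem dirDeriv_add (hf : SmoothFunOn I U f) (hf' : SmoothFunOn I U f') (hx : x ∈ U) :
    dirDeriv X (fun y ↦ f y + f' y) x = dirDeriv X f x + dirDeriv X f' x := by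
  simp [dirDeriv, mvfderiv_fun_add (hf.mdiffAt hx) (hf'.mdiffAt hx)]

theorem dirDeriv_sub (hf : SmoothFunOn I U f) (hf' : SmoothFunOn I U f') (hx : x ∈ U) :
    dirDeriv X (fun y ↦ f y - f' y) x = dirDeriv X f x - dirDeriv X f' x := by
  simp [dirDeriv, mvfderiv_fun_sub (hf.mdiffAt hx) (hf'.mdiffAt hx)]

theorem dirDeriv_mul (hf : SmoothFunOn I U f) (hf' : SmoothFunOn I U f') (hx : x ∈ U) :
    dirDeriv X (fun y ↦ f y * f' y) x = f x * dirDeriv X f' x + f' x * dirDeriv X f x := by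
  simp [dirDeriv, mvfderiv_fun_mul (hf.mdiffAt hx) (hf'.mdiffAt hx)]

theorem dirDeriv_const (c : ℝ) : dirDeriv X (fun _ ↦ c) x = 0 := by
  simp [dirDeriv, mvfderiv_const]

theorem dirDeriv_const_mul (c : ℝ) (hf : SmoothFunOn I U f) (hx : x ∈ U) :
    dirDeriv X (fun y ↦ c * f y) x = c * dirDeriv X f x := by
  rw [dirDeriv_mul (SmoothFunOn.const c) hf hx, dirDeriv_const]
  ring

theorem dirDeriv_neg : dirDeriv X (fun y ↦ - f y) x = - dirDeriv X f x := by
  simp [dirDeriv, mvfderiv_fun_neg]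

end SmoothOn

/-! ### The Levi-Civita connection and curvature in an orthonormal frame -/

section OrthonormalFrame

open VectorField Topology

set_option linter.unusedSectionVars false

variable {E : Type*} [NormedAddCommGroup E] [NormedSpace ℝ E] [FiniteDimensional ℝ E]
  {H : Type*} [TopologicalSpace H] {I : ModelWithCorners ℝ E H}
  {M : Type*} [TopologicalSpace M] [ChartedSpace H M] [IsManifold I ∞ M]

variable {g : ContMDiffRiemannianMetric I ∞ E (fun x : M ↦ TangentSpace I x)}
  {U : Set M} {X Y Z W : Π x : M, TangentSpace I x} {f f' : M → ℝ} {x : M}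

theorem covDeriv_add_right (hY : SmoothFieldOn U Y) (hZ : SmoothFieldOn U Z) (hx : x ∈ U) :
    covDeriv g X (Y + Z) x = covDeriv g X Y x + covDeriv g X Z x := by
  simp [covDeriv, (leviCivita g).isCovariantDerivativeOnUniv.add (hY.mdiffAt hx) (hZ.mdiffAt hx)]

theorem covDeriv_smul_right (hf : SmoothFunOn I U f) (hY : SmoothFieldOn U Y) (hx : x ∈ U) :
    covDeriv g X (f • Y) x = f x • covDeriv g X Y x + dirDeriv X f x • Y x := by
  simp [covDeriv, dirDeriv,
    (leviCivita g).isCovariantDerivativeOnUniv.leibniz (hY.mdiffAt hx) (hf.mdiffAt hx)]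

theorem covDeriv_congr (hU : IsOpen U) (hY : SmoothFieldOn U Y) (h : ∀ y ∈ U, Y y = Z y)
    (hXW : X x = W x) (hx : x ∈ U) : covDeriv g X Y x = covDeriv g W Z x := by
  have hZ : SmoothFieldOn U Z := hY.congr hU fun y hy ↦ (h y hy).symm
  simp only [covDeriv, hXW]
  rw [(leviCivita g).isCovariantDerivativeOnUniv.congr_of_eventuallyEq (hY.mdiffAt hx)
    (hZ.mdiffAt hx) Filter.univ_mem (Filter.eventually_of_mem (hU.mem_nhds hx) h)]

theorem covDeriv_zero_right : covDeriv g X 0 x = 0 := by simp [covDeriv]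

theorem covDeriv_sub_covDeriv (hX : SmoothFieldOn U X) (hY : SmoothFieldOn U Y) (hx : x ∈ U) :
    covDeriv g X Y x - covDeriv g Y X x = mlieBracket I X Y x :=
  leviCivita_torsionFree g (hX.mdiffAt hx) (hY.mdiffAt hx)

theorem dirDeriv_inner (hX : SmoothFieldOn U X) (hY : SmoothFieldOn U Y) (hZ : SmoothFieldOn U Z)
    (hx : x ∈ U) : dirDeriv X (fun y ↦ g.inner y (Y y) (Z y)) x
      = g.inner x (covDeriv g X Y x) (Z x) + g.inner x (Y x) (covDeriv g X Z x) :=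
  leviCivita_metric g (hX.mdiffAt hx) (hY.mdiffAt hx) (hZ.mdiffAt hx)

/-- The Koszul formula. Its right-hand side involves only brackets and derivatives of inner
products, which is how `covDeriv` inherits smoothness. -/
theorem inner_covDeriv (hX : SmoothFieldOn U X) (hY : SmoothFieldOn U Y) (hZ : SmoothFieldOn U Z)
    (hx : x ∈ U) : 2 * g.inner x (covDeriv g X Y x) (Z x) =
      dirDeriv X (fun y ↦ g.inner y (Y y) (Z y)) x + dirDeriv Y (fun y ↦ g.inner y (X y) (Z y)) x
      - dirDeriv Z (fun y ↦ g.inner y (X y) (Y y)) x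
      + g.inner x (mlieBracket I X Y x) (Z x) - g.inner x (mlieBracket I X Z x) (Y x)
      - g.inner x (mlieBracket I Y Z x) (X x) := by
  rw [dirDeriv_inner hX hY hZ hx, dirDeriv_inner hY hX hZ hx, dirDeriv_inner hZ hX hY hx,
    ← covDeriv_sub_covDeriv (g := g) hX hY hx, ← covDeriv_sub_covDeriv (g := g) hX hZ hx,
    ← covDeriv_sub_covDeriv (g := g) hY hZ hx]
  simp only [map_sub, _root_.sub_apply]
  rw [g.symm x (X x), g.symm x (X x), g.symm x (Y x)]
  ring

variable {ι : Type*} [Fintype ι] [DecidableEq ι]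

variable (g) in
/-- A smooth orthonormal frame of the tangent bundle over the open set `U`. -/
structure IsOrthonormalFrameOn (U : Set M) (e : ι → Π x : M, TangentSpace I x) : Prop where
  isOpen : IsOpen U
  smooth : ∀ i, SmoothFieldOn U (e i)
  inner_eq : ∀ y ∈ U, ∀ i j, g.inner y (e i y) (e j y) = if i = j then 1 else 0
  sum_inner_smul : ∀ y ∈ U, ∀ v, ∑ i, g.inner y v (e i y) • e i y = v

variable {e : ι → Π x : M, TangentSpace I x}

namespace IsOrthonormalFrameOn

theorem inner_eq_sum (he : IsOrthonormalFrameOn g U e) (hx : x ∈ U) (v w : TangentSpace I x) :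
    g.inner x v w = ∑ i, g.inner x v (e i x) * g.inner x w (e i x) := by
  conv_lhs => rw [← he.sum_inner_smul x hx w]
  simp [mul_comm]

theorem smoothFunOn_dirDeriv [Nonempty ι] (he : IsOrthonormalFrameOn g U e)
    (hX : SmoothFieldOn U X) (hf : SmoothFunOn I U f) : SmoothFunOn I U (dirDeriv X f) := by
  obtain ⟨i⟩ := ‹Nonempty ι›
  exact SmoothFunOn.dirDeriv g he.isOpen (he.smooth i)
    (fun y hy ↦ by simp [he.inner_eq y hy]) hX hf

theorem dirDeriv_comm [Nonempty ι] (he : IsOrthonormalFrameOn g U e)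
    (hX : SmoothFieldOn U X) (hY : SmoothFieldOn U Y) (hf : SmoothFunOn I U f) (hx : x ∈ U) :
    dirDeriv X (dirDeriv Y f) x - dirDeriv Y (dirDeriv X f) x
      = dirDeriv (mlieBracket I X Y) f x := by
  obtain ⟨i⟩ := ‹Nonempty ι›
  exact dirDeriv_commutator (g := g) he.isOpen (he.smooth i)
    (fun y hy ↦ by simp [he.inner_eq y hy]) hX hY hf hx

theorem dirDeriv_eq_sum (he : IsOrthonormalFrameOn g U e) (hx : x ∈ U) :
    dirDeriv X f x = ∑ i, g.inner x (X x) (e i x) * dirDeriv (e i) f x := by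
  simp only [dirDeriv]
  conv_lhs => rw [← he.sum_inner_smul x hx (X x)]
  simp

theorem smoothFieldOn_of_inner (he : IsOrthonormalFrameOn g U e)
    (h : ∀ i, SmoothFunOn I U (fun y ↦ g.inner y (X y) (e i y))) : SmoothFieldOn U X := by
  refine (SmoothFieldOn.sum (s := Finset.univ)
    (X := fun i ↦ (fun y ↦ g.inner y (X y) (e i y)) • e i)
    fun i _ ↦ SmoothFieldOn.smul (h i) (he.smooth i)).congr he.isOpen fun y hy ↦ ?_
  simp [he.sum_inner_smul y hy]

theorem smoothFieldOn_covDeriv [Nonempty ι] (he : IsOrthonormalFrameOn g U e)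
    (hX : SmoothFieldOn U X) (hY : SmoothFieldOn U Y) : SmoothFieldOn U (covDeriv g X Y) := by
  refine he.smoothFieldOn_of_inner fun i ↦ ?_
  have hi := he.smooth i
  refine (SmoothFunOn.const_mul (1 / 2)
    ((((((he.smoothFunOn_dirDeriv hX (.inner g hY hi)).add
      (he.smoothFunOn_dirDeriv hY (.inner g hX hi))).sub
      (he.smoothFunOn_dirDeriv hi (.inner g hX hY))).add (.inner g (hX.mlieBracket hY) hi)).sub
      (.inner g (hX.mlieBracket hi) hY)).sub (.inner g (hY.mlieBracket hi) hX))).congr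
    he.isOpen fun y hy ↦ ?_
  rw [← inner_covDeriv (g := g) hX hY hi hy]
  ring

end IsOrthonormalFrameOn

/-! ### Curvature -/

theorem curvature_eq : curvature g X Y Z x = covDeriv g X (covDeriv g Y Z) x
    - covDeriv g Y (covDeriv g X Z) x - covDeriv g (mlieBracket I X Y) Z x := rfl

theorem curvature_swap : curvature g Y X Z x = - curvature g X Y Z x := by
  simp only [curvature_eq, covDeriv]
  rw [mlieBracket_swap_apply (V := Y)]
  simp only [map_neg]
  abel

theorem curvature_congr [Nonempty ι] (he : IsOrthonormalFrameOn g U e)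
    {X' Y' Z' : Π x : M, TangentSpace I x}
    (hX : SmoothFieldOn U X) (hY : SmoothFieldOn U Y) (hZ : SmoothFieldOn U Z)
    (hXX : ∀ y ∈ U, X y = X' y) (hYY : ∀ y ∈ U, Y y = Y' y) (hZZ : ∀ y ∈ U, Z y = Z' y)
    (hx : x ∈ U) : curvature g X Y Z x = curvature g X' Y' Z' x := by
  have hU := he.isOpen
  rw [curvature_eq, curvature_eq,
    covDeriv_congr hU (he.smoothFieldOn_covDeriv hY hZ)
      (fun y hy ↦ covDeriv_congr hU hZ hZZ (hYY y hy) hy) (hXX x hx) hx,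
    covDeriv_congr hU (he.smoothFieldOn_covDeriv hX hZ)
      (fun y hy ↦ covDeriv_congr hU hZ hZZ (hXX y hy) hy) (hYY x hx) hx,
    covDeriv_congr hU hZ hZZ (mlieBracket_congr hU hXX hYY hx) hx]

theorem covDeriv_add_left : covDeriv g (X + Y) Z = covDeriv g X Z + covDeriv g Y Z := by
  ext y; simp [covDeriv]

theorem covDeriv_smul_left : covDeriv g (f • X) Z = f • covDeriv g X Z := by
  ext y; simp [covDeriv]

theorem curvature_add_left [Nonempty ι] (he : IsOrthonormalFrameOn g U e)
    (hX : SmoothFieldOn U X) (hW : SmoothFieldOn U W) (hZ : SmoothFieldOn U Z) (hx : x ∈ U) :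
    curvature g (X + W) Y Z x = curvature g X Y Z x + curvature g W Y Z x := by
  simp only [curvature_eq]
  rw [covDeriv_add_left, covDeriv_add_left, covDeriv_add_right (he.smoothFieldOn_covDeriv hX hZ)
    (he.smoothFieldOn_covDeriv hW hZ) hx]
  have : covDeriv g (mlieBracket I (X + W) Y) Z x
      = covDeriv g (mlieBracket I X Y) Z x + covDeriv g (mlieBracket I W Y) Z x := by
    simp [covDeriv, mlieBracket_add_left (hX.mdiffAt hx) (hW.mdiffAt hx)]
  rw [this]
  simp only [Pi.add_apply]
  abel

theorem curvature_smul_left [Nonempty ι] (he : IsOrthonormalFrameOn g U e)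
    (hf : SmoothFunOn I U f) (hX : SmoothFieldOn U X) (hZ : SmoothFieldOn U Z) (hx : x ∈ U) :
    curvature g (f • X) Y Z x = f x • curvature g X Y Z x := by
  simp only [curvature_eq]
  rw [covDeriv_smul_left, covDeriv_smul_left,
    covDeriv_smul_right hf (he.smoothFieldOn_covDeriv hX hZ) hx]
  have : covDeriv g (mlieBracket I (f • X) Y) Z x
      = f x • covDeriv g (mlieBracket I X Y) Z x - dirDeriv Y f x • covDeriv g X Z x := by
    simp [covDeriv, dirDeriv, mlieBracket_smul_left (hf.mdiffAt hx) (hX.mdiffAt hx)]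
    abel
  rw [this]
  simp only [Pi.smul_apply', smul_sub]
  abel

theorem curvature_add_right [Nonempty ι] (he : IsOrthonormalFrameOn g U e)
    (hX : SmoothFieldOn U X) (hY : SmoothFieldOn U Y) (hZ : SmoothFieldOn U Z)
    (hW : SmoothFieldOn U W) (hx : x ∈ U) :
    curvature g X Y (Z + W) x = curvature g X Y Z x + curvature g X Y W x := by
  have key : ∀ {V V' : Π x : M, TangentSpace I x}, SmoothFieldOn U V → SmoothFieldOn U V' →
      covDeriv g V (covDeriv g V' (Z + W)) x
        = covDeriv g V (covDeriv g V' Z) x + covDeriv g V (covDeriv g V' W) x :=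
    fun {V V'} hV hV' ↦ by
      rw [← covDeriv_add_right (he.smoothFieldOn_covDeriv hV' hZ)
        (he.smoothFieldOn_covDeriv hV' hW) hx]
      exact covDeriv_congr he.isOpen (he.smoothFieldOn_covDeriv hV' (hZ.add hW))
        (fun y hy ↦ covDeriv_add_right hZ hW hy) rfl hx
  rw [curvature_eq, key hX hY, key hY hX, covDeriv_add_right hZ hW hx, curvature_eq, curvature_eq]
  abel

/-- The second derivatives of `f` enter as the commutator of `X` and `Y` on `f`, which cancels the
derivative of `f` along `[X, Y]` coming from the last curvature term. -/
theorem curvature_smul_right [Nonempty ι] (he : IsOrthonormalFrameOn g U e)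
    (hf : SmoothFunOn I U f)
    (hX : SmoothFieldOn U X) (hY : SmoothFieldOn U Y) (hZ : SmoothFieldOn U Z) (hx : x ∈ U) :
    curvature g X Y (f • Z) x = f x • curvature g X Y Z x := by
  have key : ∀ {V V' : Π x : M, TangentSpace I x}, SmoothFieldOn U V → SmoothFieldOn U V' →
      covDeriv g V (covDeriv g V' (f • Z)) x
        = f x • covDeriv g V (covDeriv g V' Z) x + dirDeriv V f x • covDeriv g V' Z x
          + dirDeriv V' f x • covDeriv g V Z x + dirDeriv V (dirDeriv V' f) x • Z x :=
    fun {V V'} hV hV' ↦ by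
      have h1 := he.smoothFieldOn_covDeriv hV' hZ
      have h2 := he.smoothFunOn_dirDeriv hV' hf
      rw [covDeriv_congr he.isOpen (he.smoothFieldOn_covDeriv hV' (.smul hf hZ))
        (Z := f • covDeriv g V' Z + dirDeriv V' f • Z) (W := V)
        (fun y hy ↦ covDeriv_smul_right hf hZ hy) rfl hx,
        covDeriv_add_right (.smul hf h1) (.smul h2 hZ) hx, covDeriv_smul_right hf h1 hx,
        covDeriv_smul_right h2 hZ hx]
      abel
  rw [curvature_eq, key hX hY, key hY hX, covDeriv_smul_right hf hZ hx, curvature_eq,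
    ← he.dirDeriv_comm hX hY hf hx]
  module

theorem curvature_zero_left : curvature g 0 Y Z x = 0 := by
  have : covDeriv g 0 Z = 0 := by ext y; simp [covDeriv]
  simp [curvature_eq, this, covDeriv_zero_right]
  simp [covDeriv]

theorem curvature_zero_right : curvature g X Y 0 x = 0 := by
  have : ∀ V : Π x : M, TangentSpace I x, covDeriv g V 0 = 0 := fun V ↦ by
    ext y; simp [covDeriv]
  simp [curvature_eq, this]

theorem curvature_sum_left [Nonempty ι] (he : IsOrthonormalFrameOn g U e) {κ : Type*}
    (s : Finset κ) {f : κ → M → ℝ} {V : κ → Π x : M, TangentSpace I x}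
    (hf : ∀ i, SmoothFunOn I U (f i)) (hV : ∀ i, SmoothFieldOn U (V i))
    (hZ : SmoothFieldOn U Z) (hx : x ∈ U) :
    curvature g (∑ i ∈ s, f i • V i) Y Z x = ∑ i ∈ s, f i x • curvature g (V i) Y Z x := by
  classical
  induction s using Finset.induction_on with
  | empty => simp [curvature_zero_left]
  | insert a s ha ih =>
    rw [Finset.sum_insert ha, Finset.sum_insert ha, ← ih, curvature_add_left he
      (.smul (hf a) (hV a)) (.sum fun i _ ↦ .smul (hf i) (hV i)) hZ hx,
      curvature_smul_left he (hf a) (hV a) hZ hx]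

theorem curvature_sum_right [Nonempty ι] (he : IsOrthonormalFrameOn g U e) {κ : Type*}
    (s : Finset κ) {f : κ → M → ℝ} {V : κ → Π x : M, TangentSpace I x}
    (hf : ∀ i, SmoothFunOn I U (f i)) (hV : ∀ i, SmoothFieldOn U (V i))
    (hX : SmoothFieldOn U X) (hY : SmoothFieldOn U Y) (hx : x ∈ U) :
    curvature g X Y (∑ i ∈ s, f i • V i) x = ∑ i ∈ s, f i x • curvature g X Y (V i) x := by
  classical
  induction s using Finset.induction_on with
  | empty => simp [curvature_zero_right]
  | insert a s ha ih =>
    rw [Finset.sum_insert ha, Finset.sum_insert ha, ← ih, curvature_add_right he hX hY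
      (.smul (hf a) (hV a)) (.sum fun i _ ↦ .smul (hf i) (hV i)) hx,
      curvature_smul_right he (hf a) hX hY (hV a) hx]

namespace IsOrthonormalFrameOn

theorem eq_sum_smul (he : IsOrthonormalFrameOn g U e) (X : Π x : M, TangentSpace I x)
    {y : M} (hy : y ∈ U) :
    X y = (∑ i, (fun y ↦ g.inner y (X y) (e i y)) • e i) y := by
  simp [he.sum_inner_smul y hy]

/-- Tensoriality: frame coefficients are pulled out one slot at a time, the middle slot being
reduced to the first by antisymmetry. -/
theorem curvature_expand [Nonempty ι] (he : IsOrthonormalFrameOn g U e)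
    (hX : SmoothFieldOn U X) (hY : SmoothFieldOn U Y) (hZ : SmoothFieldOn U Z) (hx : x ∈ U) :
    curvature g X Y Z x = ∑ i, ∑ j, ∑ k, (g.inner x (X x) (e i x) * g.inner x (Y x) (e j x)
      * g.inner x (Z x) (e k x)) • curvature g (e i) (e j) (e k) x := by
  have hs := he.smooth
  have h1 : ∀ {Y : Π x : M, TangentSpace I x}, SmoothFieldOn U Y → ∀ k,
      SmoothFunOn I U (fun y ↦ g.inner y (Y y) (e k y)) := fun hY k ↦ .inner g hY (hs k)
  rw [curvature_congr he hX hY hZ (fun y hy ↦ he.eq_sum_smul X hy) (fun y hy ↦ rfl)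
    (fun y hy ↦ rfl) hx, curvature_sum_left he _ (h1 hX) hs hZ hx]
  refine Finset.sum_congr rfl fun i _ ↦ ?_
  rw [curvature_swap, curvature_congr he hY (hs i) hZ (fun y hy ↦ he.eq_sum_smul Y hy)
    (fun y hy ↦ rfl) (fun y hy ↦ rfl) hx, curvature_sum_left he _ (h1 hY) hs hZ hx,
    ← Finset.sum_neg_distrib, Finset.smul_sum]
  refine Finset.sum_congr rfl fun j _ ↦ ?_
  rw [curvature_swap, curvature_congr he (hs i) (hs j) hZ (fun y hy ↦ rfl)
    (fun y hy ↦ rfl) (fun y hy ↦ he.eq_sum_smul Z hy) hx,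
    curvature_sum_right he _ (h1 hZ) hs (hs i) (hs j) hx]
  simp [Finset.smul_sum, smul_smul, mul_assoc]

theorem mono {V : Set M} (he : IsOrthonormalFrameOn g U e) (hV : IsOpen V) (hVU : V ⊆ U) :
    IsOrthonormalFrameOn g V e where
  isOpen := hV
  smooth i y hy := he.smooth i y (hVU hy)
  inner_eq y hy := he.inner_eq y (hVU hy)
  sum_inner_smul y hy := he.sum_inner_smul y (hVU hy)

theorem _root_.exists_isOpen_smoothFieldOn_extend (v : TangentSpace I x) :
    ∃ V, IsOpen V ∧ x ∈ V ∧ SmoothFieldOn V (extend E v : Π x : M, TangentSpace I x) := by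
  obtain ⟨s, hs, h⟩ := exists_contMDiffOn_extend I E (k := ∞) v
  obtain ⟨V, hVs, hV, hxV⟩ := mem_nhds_iff.1 hs
  exact ⟨V, hV, hxV, fun y hy ↦ (h.mono hVs).contMDiffAt (hV.mem_nhds hy)⟩

theorem curvatureTensor_expand [Nonempty ι] (he : IsOrthonormalFrameOn g U e) (hx : x ∈ U)
    (u v w : TangentSpace I x) :
    curvatureTensor g x u v w = ∑ i, ∑ j, ∑ k, (g.inner x u (e i x) * g.inner x v (e j x)
      * g.inner x w (e k x)) • curvature g (e i) (e j) (e k) x := by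
  obtain ⟨V₁, hV₁, hx₁, h₁⟩ := exists_isOpen_smoothFieldOn_extend u
  obtain ⟨V₂, hV₂, hx₂, h₂⟩ := exists_isOpen_smoothFieldOn_extend v
  obtain ⟨V₃, hV₃, hx₃, h₃⟩ := exists_isOpen_smoothFieldOn_extend w
  -- The extensions are known to be smooth only near `x`, so the frame is restricted to where all
  -- three are.
  have he' := he.mono (V := U ∩ V₁ ∩ V₂ ∩ V₃) (((he.isOpen.inter hV₁).inter hV₂).inter hV₃)
    fun y hy ↦ hy.1.1.1
  rw [curvatureTensor, he'.curvature_expand (fun y hy ↦ h₁ y hy.1.1.2) (fun y hy ↦ h₂ y hy.1.2)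
    (fun y hy ↦ h₃ y hy.2) ⟨⟨⟨hx, hx₁⟩, hx₂⟩, hx₃⟩]
  simp

/-- A trace does not depend on the orthonormal basis: Parseval replaces the arbitrary basis chosen
at `x` by the frame. -/
theorem ricciOperator_eq [Nonempty ι] (he : IsOrthonormalFrameOn g U e) (hx : x ∈ U) (i : ι) :
    ricciOperator g x (e i x) = ∑ j, curvature g (e i) (e j) (e j) x := by
  have parseval : ∀ j k : ι, ∑ a, g.inner x (orthonormalBasisAt g x a) (e j x)
      * g.inner x (orthonormalBasisAt g x a) (e k x) = if j = k then 1 else 0 := fun j k ↦ by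
    rw [← he.inner_eq x hx]
    conv_rhs => rw [← (orthonormalBasisAt g x).sum_repr (e j x)]
    have : ∀ a, (orthonormalBasisAt g x).repr (e j x) a
        = g.inner x (orthonormalBasisAt g x a) (e j x) := fun a ↦ by
      conv_rhs => rw [← (orthonormalBasisAt g x).sum_repr (e j x)]
      simp only [map_sum, map_smul, orthonormalBasisAt_spec]
      simp
    simp [this]
  simp only [ricciOperator, he.curvatureTensor_expand hx, he.inner_eq x hx]
  calc _ = ∑ a, ∑ j, ∑ k, (g.inner x (orthonormalBasisAt g x a) (e j x)
      * g.inner x (orthonormalBasisAt g x a) (e k x)) • curvature g (e i) (e j) (e k) x := by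
        refine Finset.sum_congr rfl fun a _ ↦ ?_
        rw [Finset.sum_eq_single i (fun b _ hb ↦ by simp [hb.symm]) (by simp)]
        simp
    _ = ∑ j, ∑ k, (if j = k then 1 else 0 : ℝ) • curvature g (e i) (e j) (e k) x := by
        rw [Finset.sum_comm]
        refine Finset.sum_congr rfl fun j _ ↦ ?_
        rw [Finset.sum_comm]
        refine Finset.sum_congr rfl fun k _ ↦ ?_
        rw [← parseval j k, Finset.sum_smul]
    _ = _ := by simp

end IsOrthonormalFrameOn

end OrthonormalFrame

/-! ### Connection coefficients; curvature and Jacobi identity in terms of them -/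

section Christoffel

open VectorField Topology

set_option linter.unusedSectionVars false

variable {E : Type*} [NormedAddCommGroup E] [NormedSpace ℝ E] [FiniteDimensional ℝ E]
  {H : Type*} [TopologicalSpace H] {I : ModelWithCorners ℝ E H}
  {M : Type*} [TopologicalSpace M] [ChartedSpace H M] [IsManifold I ∞ M]

variable {g : ContMDiffRiemannianMetric I ∞ E (fun x : M ↦ TangentSpace I x)}
  {U : Set M} {X Y Z W : Π x : M, TangentSpace I x} {f f' : M → ℝ} {x : M}
  {ι : Type*} [Fintype ι] [DecidableEq ι] {e : ι → Π x : M, TangentSpace I x}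

variable (g) in
/-- The connection coefficient `g(∇_{eᵢ} eⱼ, eₖ)` of a frame. -/
def christoffel (e : ι → Π x : M, TangentSpace I x) (i j k : ι) (x : M) : ℝ :=
  g.inner x (covDeriv g (e i) (e j) x) (e k x)

namespace IsOrthonormalFrameOn

variable [Nonempty ι]

theorem smoothFunOn_christoffel (he : IsOrthonormalFrameOn g U e) (i j k : ι) :
    SmoothFunOn I U (christoffel g e i j k) :=
  .inner g (he.smoothFieldOn_covDeriv (he.smooth i) (he.smooth j)) (he.smooth k)

theorem christoffel_swap (he : IsOrthonormalFrameOn g U e) (i j k : ι) (hx : x ∈ U) :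
    christoffel g e i k j x = - christoffel g e i j k x := by
  have h := dirDeriv_inner (g := g) (he.smooth i) (he.smooth j) (he.smooth k) hx
  rw [dirDeriv_congr he.isOpen (fun y hy ↦ he.inner_eq y hy j k) hx, dirDeriv_const,
    g.symm x (e j x)] at h
  simp only [christoffel]
  linarith

theorem inner_mlieBracket (he : IsOrthonormalFrameOn g U e) (i j k : ι) (hx : x ∈ U) :
    g.inner x (mlieBracket I (e i) (e j) x) (e k x)
      = christoffel g e i j k x - christoffel g e j i k x := by
  rw [← covDeriv_sub_covDeriv (g := g) (he.smooth i) (he.smooth j) hx]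
  simp [christoffel]

/-- Differentiate g(∇_{eⱼ} eₖ, eₗ) along eᵢ by metric compatibility and expand the remaining product
in the frame. -/
theorem inner_covDeriv_covDeriv (he : IsOrthonormalFrameOn g U e) (i j k l : ι) (hx : x ∈ U) :
    g.inner x (covDeriv g (e i) (covDeriv g (e j) (e k)) x) (e l x)
      = dirDeriv (e i) (christoffel g e j k l) x
        - ∑ m, christoffel g e j k m x * christoffel g e i l m x := by
  have h := dirDeriv_inner (g := g) (he.smooth i)
    (he.smoothFieldOn_covDeriv (he.smooth j) (he.smooth k)) (he.smooth l) hx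
  rw [he.inner_eq_sum hx (covDeriv g (e j) (e k) x)] at h
  simp only [christoffel] at h ⊢
  rw [← sub_eq_iff_eq_add] at h
  exact h.symm

theorem inner_curvature (he : IsOrthonormalFrameOn g U e) (i j k l : ι) (hx : x ∈ U) :
    g.inner x (curvature g (e i) (e j) (e k) x) (e l x)
      = dirDeriv (e i) (christoffel g e j k l) x - dirDeriv (e j) (christoffel g e i k l) x
        + ∑ m, (christoffel g e i k m x * christoffel g e j l m x
          - christoffel g e j k m x * christoffel g e i l m x
          - (christoffel g e i j m x - christoffel g e j i m x) * christoffel g e m k l x) := by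
  have h : g.inner x (covDeriv g (mlieBracket I (e i) (e j)) (e k) x) (e l x)
      = ∑ m, (christoffel g e i j m x - christoffel g e j i m x) * christoffel g e m k l x := by
    simp only [covDeriv]
    conv_lhs => rw [← he.sum_inner_smul x hx (mlieBracket I (e i) (e j) x)]
    simp [he.inner_mlieBracket _ _ _ hx, christoffel, covDeriv]
  rw [curvature_eq]
  simp only [map_sub, _root_.sub_apply, he.inner_covDeriv_covDeriv _ _ _ _ hx, h,
    Finset.sum_sub_distrib]
  ring

theorem dirDeriv_comm_frame (he : IsOrthonormalFrameOn g U e) (i j : ι)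
    (hf : SmoothFunOn I U f) (hx : x ∈ U) :
    dirDeriv (e i) (dirDeriv (e j) f) x - dirDeriv (e j) (dirDeriv (e i) f) x
      = ∑ m, (christoffel g e i j m x - christoffel g e j i m x) * dirDeriv (e m) f x := by
  rw [he.dirDeriv_comm (he.smooth i) (he.smooth j) hf hx, he.dirDeriv_eq_sum hx]
  simp only [he.inner_mlieBracket _ _ _ hx]

theorem inner_mlieBracket_mlieBracket (he : IsOrthonormalFrameOn g U e) (i j k l : ι)
    (hx : x ∈ U) :
    g.inner x (mlieBracket I (e i) (mlieBracket I (e j) (e k)) x) (e l x)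
      = dirDeriv (e i) (christoffel g e j k l) x - dirDeriv (e i) (christoffel g e k j l) x
        + ∑ m, (christoffel g e j k m x - christoffel g e k j m x)
          * (christoffel g e i m l x - christoffel g e m i l x) := by
  have hjk := (he.smooth j).mlieBracket (he.smooth k)
  have h1 := dirDeriv_inner (g := g) (he.smooth i) hjk (he.smooth l) hx
  rw [dirDeriv_congr he.isOpen (fun y hy ↦ he.inner_mlieBracket j k l hy) hx,
    dirDeriv_sub (he.smoothFunOn_christoffel j k l) (he.smoothFunOn_christoffel k j l) hx] at h1
  rw [← covDeriv_sub_covDeriv (g := g) (he.smooth i) hjk hx]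
  have h2 : g.inner x (covDeriv g (mlieBracket I (e j) (e k)) (e i) x) (e l x)
      = ∑ m, (christoffel g e j k m x - christoffel g e k j m x) * christoffel g e m i l x := by
    simp only [covDeriv]
    conv_lhs => rw [← he.sum_inner_smul x hx (mlieBracket I (e j) (e k) x)]
    simp [he.inner_mlieBracket _ _ _ hx, christoffel, covDeriv]
  have h3 : g.inner x (mlieBracket I (e j) (e k) x) (covDeriv g (e i) (e l) x)
      = - ∑ m, (christoffel g e j k m x - christoffel g e k j m x) * christoffel g e i m l x := by
    rw [he.inner_eq_sum hx, ← Finset.sum_neg_distrib]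
    refine Finset.sum_congr rfl fun m _ ↦ ?_
    rw [he.inner_mlieBracket _ _ _ hx, he.christoffel_swap i l m hx]
    simp [christoffel]
  simp only [map_sub, _root_.sub_apply, h2, mul_sub, Finset.sum_sub_distrib] at h1 h3 ⊢
  linarith

theorem jacobi (he : IsOrthonormalFrameOn g U e) (i j k l : ι) (hx : x ∈ U) :
    g.inner x (mlieBracket I (e i) (mlieBracket I (e j) (e k)) x) (e l x)
      + g.inner x (mlieBracket I (e k) (mlieBracket I (e i) (e j)) x) (e l x)
      - g.inner x (mlieBracket I (e j) (mlieBracket I (e i) (e k)) x) (e l x) = 0 := by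
  have : IsManifold I (minSmoothness ℝ 3) M := by
    rw [minSmoothness_of_isRCLikeNormedField]
    exact IsManifold.of_le (n := ∞) ENat.LEInfty.out
  have h2 : ∀ {V : Π x : M, TangentSpace I x}, SmoothFieldOn U V →
      CMDiffAt (minSmoothness ℝ 2) (T% V) x := fun hV ↦ by
    rw [minSmoothness_of_isRCLikeNormedField]
    exact (hV x hx).of_le ENat.LEInfty.out
  rw [leibniz_identity_mlieBracket_apply (h2 (he.smooth i)) (h2 (he.smooth j))
    (h2 (he.smooth k)), mlieBracket_swap_apply (V := e k)]
  simp

theorem sum_inner_curvature_of_ricciOperator (he : IsOrthonormalFrameOn g U e) (hx : x ∈ U)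
    (i l : ι) {v : TangentSpace I x} (h : ricciOperator g x (e i x) = v) :
    ∑ j, g.inner x (curvature g (e i) (e j) (e j) x) (e l x) = g.inner x v (e l x) := by
  rw [← h, he.ricciOperator_eq hx]
  simp

end IsOrthonormalFrameOn

end Christoffel

/-! ### The structure equations of an Eta-Einstein contact metric frame and their consequences -/

section EtaEinsteinFrame

open VectorField Topology

variable {E : Type*} [NormedAddCommGroup E] [NormedSpace ℝ E] [FiniteDimensional ℝ E]
  {H : Type*} [TopologicalSpace H] {I : ModelWithCorners ℝ E H}
  {M : Type*} [TopologicalSpace M] [ChartedSpace H M] [IsManifold I ∞ M]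

variable (g : ContMDiffRiemannianMetric I ∞ E (fun x : M ↦ TangentSpace I x))

/-- An orthonormal frame `e₀, e₁, ξ = e₂` of a contact metric 3-manifold whose Ricci operator is
`α Id + β g(ξ, ·) ξ`. -/
structure IsEtaEinsteinFrameOn (α β : M → ℝ) (U : Set M)
    (e : Fin 3 → Π x : M, TangentSpace I x) : Prop extends IsOrthonormalFrameOn g U e where
  bracket_zero_one : ∀ y ∈ U, g.inner y (mlieBracket I (e 0) (e 1) y) (e 2 y) = 2
  bracket_two : ∀ i, ∀ y ∈ U, g.inner y (mlieBracket I (e 2) (e i) y) (e 2 y) = 0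
  ricci : ∀ i, ∀ y ∈ U, ricciOperator g y (e i y)
    = α y • e i y + (β y * g.inner y (e 2 y) (e i y)) • e 2 y

variable {g} {U : Set M} {f : M → ℝ} {x : M} {e : Fin 3 → Π x : M, TangentSpace I x} {α β : M → ℝ}

namespace IsEtaEinsteinFrameOn

/-- Metric compatibility makes the last two indices skew; the first bracket condition fixes the skew
part of ∇ξ on the contact plane, and the second makes ξ geodesic. -/
theorem christoffel_pointwise (he : IsEtaEinsteinFrameOn g α β U e) (hx : x ∈ U) :
    (∀ i j, christoffel g e i j j x = 0) ∧
    (∀ i, christoffel g e i 1 0 x = - christoffel g e i 0 1 x) ∧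
    (∀ i, christoffel g e i 2 0 x = - christoffel g e i 0 2 x) ∧
    (∀ i, christoffel g e i 2 1 x = - christoffel g e i 1 2 x) ∧
    christoffel g e 1 0 2 x = christoffel g e 0 1 2 x - 2 ∧
    christoffel g e 2 0 2 x = 0 ∧ christoffel g e 2 1 2 x = 0 := by
  have hO := he.toIsOrthonormalFrameOn
  have hs := fun i j k ↦ hO.christoffel_swap i j k hx
  have hd : ∀ i j, christoffel g e i j j x = 0 := fun i j ↦ by linarith [hs i j j]
  have h1 := he.bracket_zero_one x hx
  have h2 := he.bracket_two 0 x hx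
  have h3 := he.bracket_two 1 x hx
  rw [hO.inner_mlieBracket _ _ _ hx] at h1 h2 h3
  refine ⟨hd, fun i ↦ hs i 0 1, fun i ↦ hs i 0 2, fun i ↦ hs i 1 2, by linarith, ?_, ?_⟩
  · linarith [hd 0 2]
  · linarith [hd 1 2]

/-- The relations of `christoffel_pointwise` hold on the open set `U`, so they may be
differentiated. -/
theorem dirDeriv_christoffel_pointwise (he : IsEtaEinsteinFrameOn g α β U e) (hx : x ∈ U)
    (X : Π x : M, TangentSpace I x) :
    (∀ i j, dirDeriv X (christoffel g e i j j) x = 0) ∧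
    (∀ i, dirDeriv X (christoffel g e i 1 0) x = - dirDeriv X (christoffel g e i 0 1) x) ∧
    (∀ i, dirDeriv X (christoffel g e i 2 0) x = - dirDeriv X (christoffel g e i 0 2) x) ∧
    (∀ i, dirDeriv X (christoffel g e i 2 1) x = - dirDeriv X (christoffel g e i 1 2) x) ∧
    dirDeriv X (christoffel g e 1 0 2) x = dirDeriv X (christoffel g e 0 1 2) x ∧
    dirDeriv X (christoffel g e 2 0 2) x = 0 ∧ dirDeriv X (christoffel g e 2 1 2) x = 0 := by
  have hO := he.toIsOrthonormalFrameOn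
  have hU := hO.isOpen
  have dneg : ∀ i j k : Fin 3,
      dirDeriv X (christoffel g e i k j) x = - dirDeriv X (christoffel g e i j k) x :=
    fun i j k ↦ by
      rw [← dirDeriv_neg]
      exact dirDeriv_congr hU (fun y hy ↦ hO.christoffel_swap i j k hy) hx
  refine ⟨fun i j ↦ by linarith [dneg i j j], fun i ↦ dneg i 0 1, fun i ↦ dneg i 0 2,
    fun i ↦ dneg i 1 2, ?_, ?_, ?_⟩
  · rw [dirDeriv_congr hU (fun y hy ↦ (he.christoffel_pointwise hy).2.2.2.2.1) hx,
      dirDeriv_sub (hO.smoothFunOn_christoffel 0 1 2) (.const 2) hx, dirDeriv_const, sub_zero]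
  · rw [dirDeriv_congr hU (fun y hy ↦ (he.christoffel_pointwise hy).2.2.2.2.2.1) hx,
      dirDeriv_const]
  · rw [dirDeriv_congr hU (fun y hy ↦ (he.christoffel_pointwise hy).2.2.2.2.2.2) hx,
      dirDeriv_const]

/-- The ξ-component of the Jacobi identity for ξ, `e 0`, `e 1` amounts to d(dη) = 0. The flow of ξ
thus preserves dη, so ξ is divergence-free and the symmetric part of ∇ξ is traceless. -/
theorem christoffel_one_one_two (he : IsEtaEinsteinFrameOn g α β U e) (hx : x ∈ U) :
    christoffel g e 1 1 2 x = - christoffel g e 0 0 2 x := by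
  have hO := he.toIsOrthonormalFrameOn
  obtain ⟨hd, h10, h20, h21, h102, h202, h212⟩ := he.christoffel_pointwise hx
  have dX := he.dirDeriv_christoffel_pointwise hx
  have hJ := hO.jacobi 2 0 1 2 hx
  simp only [hO.inner_mlieBracket_mlieBracket _ _ _ _ hx] at hJ
  simp only [Fin.sum_univ_three, hd, h10, h20, h21, h102, h202, h212, (dX _).1,
    (dX _).2.2.2.2.1, (dX _).2.2.2.2.2.1, (dX _).2.2.2.2.2.2] at hJ
  linarith

theorem dirDeriv_christoffel_one_one_two (he : IsEtaEinsteinFrameOn g α β U e) (hx : x ∈ U)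
    (X : Π x : M, TangentSpace I x) :
    dirDeriv X (christoffel g e 1 1 2) x = - dirDeriv X (christoffel g e 0 0 2) x := by
  rw [← dirDeriv_neg]
  exact dirDeriv_congr he.isOpen (fun y hy ↦ he.christoffel_one_one_two hy) hx

/-- The Ricci equations and the Jacobi identity, in terms of the connection coefficients. -/
theorem structure_equations (he : IsEtaEinsteinFrameOn g α β U e) {a b c s t : M → ℝ}
    (ha : christoffel g e 0 0 1 = a) (hb : christoffel g e 1 0 1 = b)
    (hc : christoffel g e 2 0 1 = c) (hs : christoffel g e 0 0 2 = s)
    (ht : christoffel g e 0 1 2 = t) (hx : x ∈ U) :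
    dirDeriv (e 0) t x - dirDeriv (e 1) s x = -2 * b x * (t x - 1) - 2 * a x * s x ∧
    dirDeriv (e 0) s x + dirDeriv (e 1) t x = 2 * a x * (t x - 1) - 2 * b x * s x ∧
    dirDeriv (e 2) s x = 2 * c x * (t x - 1) ∧
    dirDeriv (e 2) t x = -2 * c x * s x ∧
    dirDeriv (e 1) a x - dirDeriv (e 0) b x - a x ^ 2 - b x ^ 2 + 2 * c x = α x ∧
    2 * (1 - s x ^ 2 - (t x - 1) ^ 2) = α x + β x ∧
    -dirDeriv (e 2) a x - a x * s x - b x * (t x - c x - 2)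
      = -dirDeriv (e 1) s x + dirDeriv (e 0) t x - dirDeriv (e 0) c x ∧
    -dirDeriv (e 2) b x - a x * (c x + t x) + b x * s x
      = -dirDeriv (e 1) c x - dirDeriv (e 1) t x - dirDeriv (e 0) s x := by
  have hO := he.toIsOrthonormalFrameOn
  obtain ⟨hd, h10, h20, h21, h102, h202, h212⟩ := he.christoffel_pointwise hx
  have h112 := he.christoffel_one_one_two hx
  have d112 := he.dirDeriv_christoffel_one_one_two hx
  have dX := he.dirDeriv_christoffel_pointwise hx
  have hR : ∀ i l, _ := fun i l ↦ hO.sum_inner_curvature_of_ricciOperator hx i l (he.ricci i x hx)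
  have hJ := fun l ↦ hO.jacobi 2 0 1 l hx
  simp only [map_add, map_smul, _root_.add_apply, _root_.smul_apply, smul_eq_mul,
    hO.inner_eq x hx, hO.inner_curvature _ _ _ _ hx,
    Fin.sum_univ_three] at hR
  simp only [hO.inner_mlieBracket_mlieBracket _ _ _ _ hx, Fin.sum_univ_three] at hJ
  have R00 := hR 0 0
  have R01 := hR 0 1
  have R02 := hR 0 2
  have R11 := hR 1 1
  have R12 := hR 1 2
  have R22 := hR 2 2
  have J0 := hJ 0
  have J1 := hJ 1
  clear hR hJ
  simp only [hd, h10, h20, h21, h102, h202, h212, h112, d112, (dX _).1, (dX _).2.1,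
    (dX _).2.2.1, (dX _).2.2.2.1, (dX _).2.2.2.2.1, (dX _).2.2.2.2.2.1, (dX _).2.2.2.2.2.2,
    ha, hb, hc, hs, ht, Fin.reduceEq, if_true, if_false] at R00 R01 R02 R11 R12 R22 J0 J1
  -- In order: Ric(`e 1`, ξ) = 0 and Ric(`e 0`, ξ) = 0 (the divergence of the shear); the equality
  -- of the two horizontal diagonal Ricci terms and the vanishing of the off-diagonal one (the shear
  -- is parallel along ξ); their mean; Ric(ξ, ξ); and the two horizontal Jacobi components.
  refine ⟨?_, ?_, ?_, ?_, ?_, ?_, ?_, ?_⟩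
  · linear_combination -R12
  · linear_combination -R02
  · linear_combination (R00 - R11) / 2
  · linear_combination R01
  · linear_combination (R00 + R11) / 2
  · linear_combination R22
  · linear_combination J0
  · linear_combination J1

/-- The covariant derivative of the traceless part of `∇ξ` is annihilated by that traceless
part. -/
theorem shear_mul_deriv (he : IsEtaEinsteinFrameOn g α β U e) {a b c s t : M → ℝ}
    (ha : christoffel g e 0 0 1 = a) (hb : christoffel g e 1 0 1 = b)
    (hc : christoffel g e 2 0 1 = c) (hs : christoffel g e 0 0 2 = s)
    (ht : christoffel g e 0 1 2 = t) (hx : x ∈ U) :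
    s x * (dirDeriv (e 0) t x + 2 * a x * s x)
      = (t x - 1) * (dirDeriv (e 0) s x - 2 * a x * (t x - 1)) ∧
    s x * (dirDeriv (e 0) s x - 2 * a x * (t x - 1))
      = -((t x - 1) * (dirDeriv (e 0) t x + 2 * a x * s x)) := by
  have hO := he.toIsOrthonormalFrameOn
  have hU := hO.isOpen
  have E := fun y (hy : y ∈ U) ↦ he.structure_equations ha hb hc hs ht hy
  have sa : SmoothFunOn I U a := ha ▸ hO.smoothFunOn_christoffel 0 0 1
  have sb : SmoothFunOn I U b := hb ▸ hO.smoothFunOn_christoffel 1 0 1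
  have sc : SmoothFunOn I U c := hc ▸ hO.smoothFunOn_christoffel 2 0 1
  have ss : SmoothFunOn I U s := hs ▸ hO.smoothFunOn_christoffel 0 0 2
  have st : SmoothFunOn I U t := ht ▸ hO.smoothFunOn_christoffel 0 1 2
  have st1 : SmoothFunOn I U (fun y ↦ t y - 1) := st.sub (.const 1)
  have dt1 : ∀ {X : Π x : M, TangentSpace I x},
      dirDeriv X (fun y ↦ t y - 1) x = dirDeriv X t x := fun {X} ↦ by
    rw [dirDeriv_sub st (.const 1) hx, dirDeriv_const, sub_zero]
  have sD : ∀ i {f : M → ℝ}, SmoothFunOn I U f → SmoothFunOn I U (dirDeriv (e i) f) :=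
    fun i _ hf ↦ hO.smoothFunOn_dirDeriv (hO.smooth i) hf
  -- `D1` and `D2` differentiate the two divergence equations along ξ; `D3` and `D4` differentiate
  -- the equations saying that the shear is parallel along ξ.
  have D1 : dirDeriv (e 2) (dirDeriv (e 0) t) x - dirDeriv (e 2) (dirDeriv (e 1) s) x
      = -2 * b x * dirDeriv (e 2) t x + (t x - 1) * (-2 * dirDeriv (e 2) b x)
        - (2 * a x * dirDeriv (e 2) s x + s x * (2 * dirDeriv (e 2) a x)) := by
    rw [← dirDeriv_sub (sD 0 st) (sD 1 ss) hx, dirDeriv_congr hU (fun y hy ↦ (E y hy).1) hx,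
      dirDeriv_sub ((sb.const_mul (-2)).mul st1) ((sa.const_mul 2).mul ss) hx,
      dirDeriv_mul (sb.const_mul (-2)) st1 hx, dirDeriv_mul (sa.const_mul 2) ss hx,
      dirDeriv_const_mul _ sb hx, dirDeriv_const_mul _ sa hx, dt1]
  have D2 : dirDeriv (e 2) (dirDeriv (e 0) s) x + dirDeriv (e 2) (dirDeriv (e 1) t) x
      = 2 * a x * dirDeriv (e 2) t x + (t x - 1) * (2 * dirDeriv (e 2) a x)
        - (2 * b x * dirDeriv (e 2) s x + s x * (2 * dirDeriv (e 2) b x)) := by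
    rw [← dirDeriv_add (sD 0 ss) (sD 1 st) hx, dirDeriv_congr hU (fun y hy ↦ (E y hy).2.1) hx,
      dirDeriv_sub ((sa.const_mul 2).mul st1) ((sb.const_mul 2).mul ss) hx,
      dirDeriv_mul (sa.const_mul 2) st1 hx, dirDeriv_mul (sb.const_mul 2) ss hx,
      dirDeriv_const_mul _ sb hx, dirDeriv_const_mul _ sa hx, dt1]
  have D3 : ∀ {X : Π x : M, TangentSpace I x}, dirDeriv X (dirDeriv (e 2) s) x
      = 2 * c x * dirDeriv X t x + (t x - 1) * (2 * dirDeriv X c x) := fun {X} ↦ by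
    rw [dirDeriv_congr hU (fun y hy ↦ (E y hy).2.2.1) hx, dirDeriv_mul (sc.const_mul 2) st1 hx,
      dirDeriv_const_mul _ sc hx, dt1]
  have D4 : ∀ {X : Π x : M, TangentSpace I x}, dirDeriv X (dirDeriv (e 2) t) x
      = -2 * c x * dirDeriv X s x + s x * (-2 * dirDeriv X c x) := fun {X} ↦ by
    rw [dirDeriv_congr hU (fun y hy ↦ (E y hy).2.2.2.1) hx, dirDeriv_mul (sc.const_mul (-2)) ss hx,
      dirDeriv_const_mul _ sc hx]
  have C1 := hO.dirDeriv_comm_frame 2 0 ss hx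
  have C2 := hO.dirDeriv_comm_frame 2 0 st hx
  have C3 := hO.dirDeriv_comm_frame 2 1 ss hx
  have C4 := hO.dirDeriv_comm_frame 2 1 st hx
  obtain ⟨hd, h10, h20, h21, h102, h202, h212⟩ := he.christoffel_pointwise hx
  have h112 := he.christoffel_one_one_two hx
  obtain ⟨E1, E2, E3, E4, -, -, E7, E8⟩ := E x hx
  simp only [Fin.sum_univ_three, hd, h10, h20, h21, h102, h202, h212, h112,
    hc, hs, ht, D3, D4, E3, E4] at C1 C2 C3 C4 D1 D2
  have E1' : dirDeriv (e 1) s x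
      = dirDeriv (e 0) t x + 2 * b x * (t x - 1) + 2 * a x * s x := by linarith
  have E2' : dirDeriv (e 1) t x
      = 2 * a x * (t x - 1) - 2 * b x * s x - dirDeriv (e 0) s x := by linarith
  rw [E1'] at E7
  rw [E2'] at E8
  -- The Jacobi components give the ξ-derivatives of `a` and `b` in terms of horizontal derivatives
  -- of `c`; the latter cancel against those in `D3` and `D4`.
  have E7' : dirDeriv (e 2) a x = dirDeriv (e 0) c x - a x * s x - b x * (t x - c x - 2)
      + 2 * b x * (t x - 1) + 2 * a x * s x := by linarith
  have E8' : dirDeriv (e 2) b x = dirDeriv (e 1) c x - a x * (c x + t x) + b x * s x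
      + 2 * a x * (t x - 1) - 2 * b x * s x := by linarith
  simp only [E1', E2', E7', E8'] at C1 C2 C3 C4 D1 D2
  constructor
  -- These combinations with the commutators remove every second derivative.
  · linear_combination (D1 + C3 - C2) / 2
  · linear_combination (D2 - C1 - C4) / 2

/-- By the Ric(ξ, ξ) equation it suffices that ρ = s² + (t - 1)² has zero derivative. Along `e 0`
this is `shear_mul_deriv`; the divergence equations carry it over to `e 1`; along ξ the shear only
rotates. -/
theorem dirDeriv_add_eq_zero (he : IsEtaEinsteinFrameOn g α β U e) (hx : x ∈ U) (i : Fin 3) :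
    dirDeriv (e i) (fun y ↦ α y + β y) x = 0 := by
  have hO := he.toIsOrthonormalFrameOn
  set a := christoffel g e 0 0 1 with ha
  set b := christoffel g e 1 0 1 with hb
  set c := christoffel g e 2 0 1 with hc
  set s := christoffel g e 0 0 2 with hs
  set t := christoffel g e 0 1 2 with ht
  have E := fun y (hy : y ∈ U) ↦ he.structure_equations ha.symm hb.symm hc.symm hs.symm ht.symm hy
  have ss : SmoothFunOn I U s := hO.smoothFunOn_christoffel 0 0 2
  have st : SmoothFunOn I U t := hO.smoothFunOn_christoffel 0 1 2
  have st1 : SmoothFunOn I U (fun y ↦ t y - 1) := st.sub (.const 1)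
  have key : dirDeriv (e i) (fun y ↦ α y + β y) x
      = -4 * (s x * dirDeriv (e i) s x + (t x - 1) * dirDeriv (e i) t x) := by
    rw [dirDeriv_congr (f' := fun y ↦ 2 * (1 - (s y * s y + (t y - 1) * (t y - 1)))) he.isOpen
      (fun y hy ↦ by rw [← (E y hy).2.2.2.2.2.1]; ring) hx,
      dirDeriv_const_mul _ ((SmoothFunOn.const 1).sub ((ss.mul ss).add (st1.mul st1))) hx,
      dirDeriv_sub (.const 1) ((ss.mul ss).add (st1.mul st1)) hx, dirDeriv_const,
      dirDeriv_add (ss.mul ss) (st1.mul st1) hx, dirDeriv_mul ss ss hx, dirDeriv_mul st1 st1 hx,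
      dirDeriv_sub st (.const 1) hx, dirDeriv_const]
    ring
  obtain ⟨S1, S2⟩ := he.shear_mul_deriv ha.symm hb.symm hc.symm hs.symm ht.symm hx
  obtain ⟨E1, E2, E3, E4, -⟩ := E x hx
  rw [key]
  fin_cases i
  · simp only [Fin.zero_eta]
    linear_combination -4 * S2
  · simp only [Fin.mk_one]
    linear_combination 4 * s x * E1 - 4 * (t x - 1) * E2 - 4 * S1
  · simp only [Fin.reduceFinMk]
    linear_combination -4 * s x * E3 - 4 * (t x - 1) * E4

/-- The shear is now nowhere zero and parallel, so its angle integrates ±2ω and dω = 0. The fifth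
structure equation reads dω(`e 0`, `e 1`) = -α. -/
theorem eq_zero_of_add_ne_two (he : IsEtaEinsteinFrameOn g α β U e)
    (h : ∀ y ∈ U, α y + β y ≠ 2) (hx : x ∈ U) : α x = 0 := by
  have hO := he.toIsOrthonormalFrameOn
  have hU := hO.isOpen
  set a := christoffel g e 0 0 1 with ha
  set b := christoffel g e 1 0 1 with hb
  set c := christoffel g e 2 0 1 with hc
  set s := christoffel g e 0 0 2 with hs
  set t := christoffel g e 0 1 2 with ht
  have E := fun y (hy : y ∈ U) ↦ he.structure_equations ha.symm hb.symm hc.symm hs.symm ht.symm hy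
  have sa : SmoothFunOn I U a := hO.smoothFunOn_christoffel 0 0 1
  have sb : SmoothFunOn I U b := hO.smoothFunOn_christoffel 1 0 1
  have ss : SmoothFunOn I U s := hO.smoothFunOn_christoffel 0 0 2
  have st : SmoothFunOn I U t := hO.smoothFunOn_christoffel 0 1 2
  have st1 : SmoothFunOn I U (fun y ↦ t y - 1) := st.sub (.const 1)
  have hρ : ∀ y ∈ U, s y ^ 2 + (t y - 1) ^ 2 ≠ 0 := fun y hy h0 ↦
    h y hy (by linarith [(E y hy).2.2.2.2.2.1])
  -- `shear_mul_deriv` is a homogeneous linear system for the components of the `e 0`-derivative of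
  -- the shear, with determinant ρ up to sign.
  have F1 : ∀ y ∈ U, dirDeriv (e 0) s y = 2 * a y * (t y - 1) := fun y hy ↦ by
    obtain ⟨S1, S2⟩ := he.shear_mul_deriv ha.symm hb.symm hc.symm hs.symm ht.symm hy
    refine sub_eq_zero.1 ((mul_eq_zero.1 ?_).resolve_left (hρ y hy))
    linear_combination s y * S2 - (t y - 1) * S1
  have F2 : ∀ y ∈ U, dirDeriv (e 0) t y = -2 * a y * s y := fun y hy ↦ by
    obtain ⟨S1, S2⟩ := he.shear_mul_deriv ha.symm hb.symm hc.symm hs.symm ht.symm hy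
    refine sub_eq_zero.1 ((mul_eq_zero.1 ?_).resolve_left (hρ y hy))
    linear_combination s y * S1 + (t y - 1) * S2
  have F3 : ∀ y ∈ U, dirDeriv (e 1) s y = 2 * b y * (t y - 1) := fun y hy ↦ by
    linarith [(E y hy).1, F2 y hy]
  have F4 : ∀ y ∈ U, dirDeriv (e 1) t y = -2 * b y * s y := fun y hy ↦ by
    linarith [(E y hy).2.1, F1 y hy]
  have C1 := hO.dirDeriv_comm_frame 0 1 ss hx
  have C2 := hO.dirDeriv_comm_frame 0 1 st hx
  rw [dirDeriv_congr hU F1 hx, dirDeriv_congr hU F3 hx, dirDeriv_mul (sa.const_mul 2) st1 hx,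
    dirDeriv_mul (sb.const_mul 2) st1 hx, dirDeriv_sub st (.const 1) hx,
    dirDeriv_sub st (.const 1) hx, dirDeriv_const, dirDeriv_const, dirDeriv_const_mul _ sa hx,
    dirDeriv_const_mul _ sb hx] at C1
  rw [dirDeriv_congr hU F2 hx, dirDeriv_congr hU F4 hx, dirDeriv_mul (sa.const_mul (-2)) ss hx,
    dirDeriv_mul (sb.const_mul (-2)) ss hx, dirDeriv_const_mul _ sa hx,
    dirDeriv_const_mul _ sb hx] at C2
  obtain ⟨hd, h10, h20, h21, h102, h202, h212⟩ := he.christoffel_pointwise hx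
  obtain ⟨-, -, E3, E4, E5, -⟩ := E x hx
  simp only [Fin.sum_univ_three, hd, h10, h102,
    ← ha, ← hb, ← ht, E3, E4, F1 x hx, F2 x hx, F3 x hx, F4 x hx] at C1 C2
  refine (mul_eq_zero.1 ?_).resolve_left (hρ x hx)
  -- This is the angular component of the commutator identity on (s, t - 1); it equals ρ times the
  -- dω equation.
  linear_combination (t x - 1) * C1 / (-2) + s x * C2 / 2 - (s x ^ 2 + (t x - 1) ^ 2) * E5

/-- The Ric(ξ, ξ) equation forces the sum of squares ρ to vanish. -/
theorem christoffel_of_add_eq_two (he : IsEtaEinsteinFrameOn g α β U e) (hx : x ∈ U)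
    (h : α x + β x = 2) :
    christoffel g e 0 0 2 x = 0 ∧ christoffel g e 0 1 2 x = 1 := by
  obtain ⟨-, -, -, -, -, E6, -⟩ := he.structure_equations rfl rfl rfl rfl rfl hx
  constructor <;> nlinarith

/-- `∇ξ` is skew-symmetric where `α + β = 2`. -/
theorem covDeriv_skew (he : IsEtaEinsteinFrameOn g α β U e) (hx : x ∈ U) (h : α x + β x = 2)
    (v w : TangentSpace I x) :
    g.inner x (leviCivita g (e 2) x v) w + g.inner x v (leviCivita g (e 2) x w) = 0 := by
  have hO := he.toIsOrthonormalFrameOn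
  obtain ⟨h1, h2⟩ := he.christoffel_of_add_eq_two hx h
  obtain ⟨hd, h10, h20, h21, h102, h202, h212⟩ := he.christoffel_pointwise hx
  have h112 := he.christoffel_one_one_two hx
  have key : ∀ v w, g.inner x (leviCivita g (e 2) x v) w
      = ∑ i, ∑ j, g.inner x v (e i x) * g.inner x w (e j x) * christoffel g e i 2 j x :=
    fun v w ↦ by
      rw [hO.inner_eq_sum hx, Finset.sum_comm]
      refine Finset.sum_congr rfl fun j _ ↦ ?_
      conv_lhs => rw [← hO.sum_inner_smul x hx v]
      simp only [map_sum, map_smul, _root_.sum_apply, _root_.smul_apply, smul_eq_mul,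
        Finset.sum_mul, christoffel, covDeriv]
      exact Finset.sum_congr rfl fun i _ ↦ by ring
  rw [g.symm x v, key, key]
  simp only [Fin.sum_univ_three, hd, h20, h21, h102, h202, h212, h112, h1, h2]
  ring

end IsEtaEinsteinFrameOn

end EtaEinsteinFrame

/-! ### Functions with vanishing derivative -/

section LocallyConstant

open Topology

variable {E : Type*} [NormedAddCommGroup E] [NormedSpace ℝ E]
  {H : Type*} [TopologicalSpace H] {I : ModelWithCorners ℝ E H}
  {M : Type*} [TopologicalSpace M] [ChartedSpace H M] [IsManifold I 1 M]

/-- Read in a chart, `f` has zero derivative on the open chart target, where its level sets are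
therefore open. -/
theorem isLocallyConstant_of_mfderiv_eq_zero [I.Boundaryless] {f : M → ℝ}
    (hf : MDifferentiable I 𝓘(ℝ) f) (h : ∀ x, mfderiv I 𝓘(ℝ) f x = 0) : IsLocallyConstant f := by
  rw [IsLocallyConstant.iff_eventually_eq]
  intro x
  have hT : IsOpen (extChartAt I x).target := isOpen_extChartAt_target x
  have hd : ∀ y ∈ (extChartAt I x).target,
      HasFDerivAt (f ∘ (extChartAt I x).symm) (0 : E →L[ℝ] ℝ) y := fun y hy ↦ by
    have h1 : MDifferentiableAt 𝓘(ℝ, E) I (extChartAt I x).symm y :=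
      (mdifferentiableOn_extChartAt_symm y hy).mdifferentiableAt (hT.mem_nhds hy)
    have h2 := (hf ((extChartAt I x).symm y)).hasMFDerivAt
    rw [h] at h2
    have h3 := h2.comp y h1.hasMFDerivAt
    rw [ContinuousLinearMap.zero_comp] at h3
    exact h3.hasFDerivAt
  have hopen := hT.isOpen_inter_preimage_of_fderiv_eq_zero
    (fun y hy ↦ (hd y hy).differentiableAt.differentiableWithinAt)
    (fun y hy ↦ (hd y hy).fderiv) {f x}
  have hmem : extChartAt I x x ∈ (extChartAt I x).target ∩
      (f ∘ (extChartAt I x).symm) ⁻¹' {f x} :=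
    ⟨mem_extChartAt_target x, by simp⟩
  filter_upwards [(continuousAt_extChartAt x).preimage_mem_nhds (hopen.mem_nhds hmem),
    extChartAt_source_mem_nhds (I := I) x] with y hy hys
  have h1 : f ((extChartAt I x).symm (extChartAt I x y)) = f x := hy.2
  rwa [(extChartAt I x).left_inv hys] at h1

end LocallyConstant

/-! ### Completeness of orthonormal families of full size -/

section FrameOfOrthonormal

set_option linter.unusedSectionVars false

variable {E : Type*} [NormedAddCommGroup E] [NormedSpace ℝ E] [FiniteDimensional ℝ E]
  {H : Type*} [TopologicalSpace H] {I : ModelWithCorners ℝ E H}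
  {M : Type*} [TopologicalSpace M] [ChartedSpace H M] [IsManifold I ∞ M]
  {g : ContMDiffRiemannianMetric I ∞ E (fun x : M ↦ TangentSpace I x)}

theorem sum_inner_smul_of_orthonormal {ι : Type*} [Fintype ι] [DecidableEq ι]
    (hcard : Fintype.card ι = Module.finrank ℝ E) {x : M} {e : ι → TangentSpace I x}
    (he : ∀ i j, g.inner x (e i) (e j) = if i = j then 1 else 0) (v : TangentSpace I x) :
    ∑ i, g.inner x v (e i) • e i = v := by
  have : FiniteDimensional ℝ (TangentSpace I x) := inferInstanceAs (FiniteDimensional ℝ E)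
  have hli : LinearIndependent ℝ e := by
    rw [Fintype.linearIndependent_iff]
    intro c hc i
    have := congr(g.inner x $hc (e i))
    simpa [he] using this
  let b := basisOfLinearIndependentOfCardEqFinrank' e hli hcard
  have hb : ∀ i, b i = e i := fun i ↦ congrFun (coe_basisOfLinearIndependentOfCardEqFinrank' e hli hcard) i
  have hv := b.sum_repr v
  simp only [hb] at hv
  conv_rhs => rw [← hv]
  refine Finset.sum_congr rfl fun i _ ↦ ?_
  conv_lhs => rw [← hv]
  simp [he]

end FrameOfOrthonormal

/-! ### Contact metric algebra and the adapted frame -/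

namespace ContactMetricStructure

open VectorField Topology

variable {M : Type*} [TopologicalSpace M] [ChartedSpace (EuclideanSpace ℝ (Fin 3)) M]
  [IsManifold (𝓡 3) ∞ M] (S : ContactMetricStructure M) {x : M} {U : Set M}

/-- φ is skew because dη is. -/
theorem inner_φ_right (x : M) (u v : TangentSpace (𝓡 3) x) :
    S.g.inner x u (S.φ x v) = - S.g.inner x v (S.φ x u) := by
  have h1 := S.dη_eq x u v
  have h2 := S.dη_eq x v u
  rw [extDerivOneForm, mlieBracket_swap_apply, map_neg] at h2
  rw [extDerivOneForm] at h1
  linarith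

theorem inner_ξ_φ (x : M) (u : TangentSpace (𝓡 3) x) : S.g.inner x (S.ξ x) (S.φ x u) = 0 := by
  rw [S.inner_φ_right, S.φ_ξ]
  simp

/-- Pair ξ with φ²u: the result is zero by skewness of φ, and -g(ξ, u) + η(u) by the formula for φ².
-/
theorem η_eq (x : M) (u : TangentSpace (𝓡 3) x) : S.η x u = S.g.inner x (S.ξ x) u := by
  have h := S.inner_ξ_φ x (S.φ x u)
  rw [S.φ_sq] at h
  simp only [map_add, map_neg, map_smul, S.unit_ξ, smul_eq_mul] at h
  linarith

theorem inner_φ_φ (x : M) {u : TangentSpace (𝓡 3) x} (hu : S.g.inner x (S.ξ x) u = 0) :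
    S.g.inner x (S.φ x u) (S.φ x u) = S.g.inner x u u := by
  rw [S.inner_φ_right, S.φ_sq, S.η_eq, hu]
  simp

theorem inner_self_φ (x : M) (u : TangentSpace (𝓡 3) x) : S.g.inner x u (S.φ x u) = 0 := by
  linarith [S.inner_φ_right x u u]

theorem smoothFieldOn_ξ : SmoothFieldOn U S.ξ := fun y _ ↦ S.smooth_ξ y

theorem smoothFieldOn_φ {X : Π x : M, TangentSpace (𝓡 3) x} (hX : SmoothFieldOn U X) :
    SmoothFieldOn U (fun y ↦ S.φ y (X y)) := fun y hy ↦
  ContMDiffAt.clm_bundle_apply (F₁ := EuclideanSpace ℝ (Fin 3))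
    (F₂ := EuclideanSpace ℝ (Fin 3)) (S.smooth_φ y) (hX y hy)

theorem dη_formula {X Y : Π x : M, TangentSpace (𝓡 3) x} (hX : SmoothFieldOn U X)
    (hY : SmoothFieldOn U Y) (hx : x ∈ U) :
    dirDeriv X (fun y ↦ S.g.inner y (S.ξ y) (Y y)) x
      - dirDeriv Y (fun y ↦ S.g.inner y (S.ξ y) (X y)) x
      - S.g.inner x (S.ξ x) (mlieBracket (𝓡 3) X Y x)
    = S.g.inner x (leviCivita S.g S.ξ x (X x)) (Y x)
      - S.g.inner x (leviCivita S.g S.ξ x (Y x)) (X x) := by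
  have hξ : SmoothFieldOn U S.ξ := S.smoothFieldOn_ξ
  rw [dirDeriv_inner hX hξ hY hx, dirDeriv_inner hY hξ hX hx,
    ← covDeriv_sub_covDeriv (g := S.g) hX hY hx]
  simp only [map_sub, covDeriv]
  ring

/-- dη is twice the skew part of ∇ξ. This frees it from the chosen extensions, so that `dη_eq`
applies to arbitrary smooth fields. -/
theorem extDeriv_eq (x : M) (u v : TangentSpace (𝓡 3) x) :
    extDerivOneForm S.η x u v = S.g.inner x (leviCivita S.g S.ξ x u) v
      - S.g.inner x (leviCivita S.g S.ξ x v) u := by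
  obtain ⟨V₁, hV₁, hx₁, h₁⟩ := exists_isOpen_smoothFieldOn_extend u
  obtain ⟨V₂, hV₂, hx₂, h₂⟩ := exists_isOpen_smoothFieldOn_extend v
  have h := S.dη_formula (U := V₁ ∩ V₂) (fun y hy ↦ h₁ y hy.1) (fun y hy ↦ h₂ y hy.2)
    (x := x) ⟨hx₁, hx₂⟩
  simp only [extend_apply_self, dirDeriv] at h
  simp only [extDerivOneForm, S.η_eq]
  exact h

theorem dη_fields {X Y : Π x : M, TangentSpace (𝓡 3) x} (hX : SmoothFieldOn U X)
    (hY : SmoothFieldOn U Y) (hx : x ∈ U) :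
    dirDeriv X (fun y ↦ S.g.inner y (S.ξ y) (Y y)) x
      - dirDeriv Y (fun y ↦ S.g.inner y (S.ξ y) (X y)) x
      - S.g.inner x (S.ξ x) (mlieBracket (𝓡 3) X Y x) = 2 * S.g.inner x (X x) (S.φ x (Y x)) := by
  rw [S.dη_formula hX hY hx, ← S.dη_eq, S.extDeriv_eq]

theorem inner_bracket_ξ {X Y : Π x : M, TangentSpace (𝓡 3) x} (hX : SmoothFieldOn U X)
    (hY : SmoothFieldOn U Y) (hU : IsOpen U) {p q : ℝ}
    (hXξ : ∀ y ∈ U, S.g.inner y (S.ξ y) (X y) = p) (hYξ : ∀ y ∈ U, S.g.inner y (S.ξ y) (Y y) = q)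
    (hx : x ∈ U) : S.g.inner x (mlieBracket (𝓡 3) X Y x) (S.ξ x)
      = -2 * S.g.inner x (X x) (S.φ x (Y x)) := by
  have h := S.dη_fields hX hY hx
  rw [dirDeriv_congr hU hXξ hx, dirDeriv_congr hU hYξ hx, dirDeriv_const, dirDeriv_const,
    S.g.symm x (S.ξ x)] at h
  linarith

theorem exists_horizontal_vector (x : M) :
    ∃ v : TangentSpace (𝓡 3) x, v - S.g.inner x (S.ξ x) v • S.ξ x ≠ 0 := by
  by_contra! h
  have h1 := finrank_le_one (R := ℝ) (S.ξ x) fun w ↦ ⟨_, (sub_eq_zero.1 (h w)).symm⟩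
  have h2 : Module.finrank ℝ (TangentSpace (𝓡 3) x) = 3 :=
    finrank_euclideanSpace_fin (𝕜 := ℝ) (n := 3)
  omega

/-- Near every point there is a smooth unit field orthogonal to `ξ`. -/
theorem exists_unit_horizontal_field (x : M) :
    ∃ (U : Set M) (X : Π x : M, TangentSpace (𝓡 3) x), IsOpen U ∧ x ∈ U ∧ SmoothFieldOn U X ∧
      ∀ y ∈ U, S.g.inner y (X y) (X y) = 1 ∧ S.g.inner y (S.ξ y) (X y) = 0 := by
  obtain ⟨v, hv⟩ := S.exists_horizontal_vector x
  obtain ⟨V, hV, hxV, hsm⟩ := exists_isOpen_smoothFieldOn_extend v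
  let Y : Π x : M, TangentSpace (𝓡 3) x := extend (EuclideanSpace ℝ (Fin 3)) v
  have hξ : SmoothFieldOn V S.ξ := S.smoothFieldOn_ξ
  -- The projection of `Y` orthogonal to ξ, nonzero at `x` by the choice of `v`; it is normalized
  -- where its length is positive.
  let W : Π x : M, TangentSpace (𝓡 3) x :=
    Y + (fun y ↦ - S.g.inner y (S.ξ y) (Y y)) • S.ξ
  have hW : SmoothFieldOn V W := hsm.add (.smul (SmoothFunOn.inner S.g hξ hsm).neg hξ)
  have hn := SmoothFunOn.inner S.g hW hW
  have hWξ : ∀ y, S.g.inner y (S.ξ y) (W y) = 0 := fun y ↦ by simp [W, S.unit_ξ]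
  have hcont : ContinuousOn (fun y ↦ S.g.inner y (W y) (W y)) V := fun y hy ↦
    (hn y hy).continuousAt.continuousWithinAt
  refine ⟨V ∩ (fun y ↦ S.g.inner y (W y) (W y)) ⁻¹' Set.Ioi 0,
    (fun y ↦ (√(S.g.inner y (W y) (W y)))⁻¹) • W,
    hcont.isOpen_inter_preimage hV isOpen_Ioi, ⟨hxV, ?_⟩, ?_, ?_⟩
  · refine S.g.pos x (W x) ?_
    simpa [W, Y, sub_eq_add_neg] using hv
  · refine .smul (fun y hy ↦ ?_) fun y hy ↦ hW y hy.1
    have hpos : 0 < S.g.inner y (W y) (W y) := hy.2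
    have h1 : ContDiffAt ℝ ∞ (fun r : ℝ ↦ (√r)⁻¹) (S.g.inner y (W y) (W y)) :=
      (contDiffAt_id.sqrt hpos.ne').inv (Real.sqrt_pos.2 hpos).ne'
    exact ContMDiffAt.comp (g := fun r : ℝ ↦ (√r)⁻¹) y h1.contMDiffAt (hn y hy.1)
  · intro y hy
    have hpos : 0 < S.g.inner y (W y) (W y) := hy.2
    simp only [Pi.smul_apply', map_smul, _root_.smul_apply, smul_eq_mul, hWξ, mul_zero, and_true]
    rw [← mul_assoc, ← mul_inv, Real.mul_self_sqrt hpos.le, inv_mul_cancel₀ hpos.ne']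

/-- Near every point there is an orthonormal frame `X, φ X, ξ`. -/
theorem exists_frame {α β : M → ℝ} (hαβ : S.IsGeneralizedEtaEinsteinWith α β) (x : M) :
    ∃ (U : Set M) (e : Fin 3 → Π x : M, TangentSpace (𝓡 3) x), x ∈ U ∧ e 2 = S.ξ ∧
      IsEtaEinsteinFrameOn S.g α β U e := by
  obtain ⟨U, X, hU, hx, hX, hXy⟩ := S.exists_unit_horizontal_field x
  have hξ : SmoothFieldOn U S.ξ := S.smoothFieldOn_ξ
  let e : Fin 3 → Π x : M, TangentSpace (𝓡 3) x := ![X, fun y ↦ S.φ y (X y), S.ξ]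
  have hsm : ∀ i, SmoothFieldOn U (e i) := by
    intro i
    fin_cases i
    exacts [hX, S.smoothFieldOn_φ hX, hξ]
  have hinner : ∀ y ∈ U, ∀ i j, S.g.inner y (e i y) (e j y) = if i = j then 1 else 0 := by
    intro y hy i j
    obtain ⟨h1, h2⟩ := hXy y hy
    have h3 := S.inner_φ_φ y h2
    have h4 := S.inner_self_φ y (X y)
    have h5 := S.inner_ξ_φ y (X y)
    have h6 := S.unit_ξ y
    have h7 := S.g.symm y (S.ξ y)
    have h8 := S.g.symm y (X y)
    fin_cases i <;> fin_cases j <;> simp [e, h1, h2, h3, h4, h5, h6, ← h7, ← h8]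
  have hO : IsOrthonormalFrameOn S.g U e := ⟨hU, hsm, hinner, fun y hy v ↦
    sum_inner_smul_of_orthonormal (by simp) (hinner y hy) v⟩
  refine ⟨U, e, hx, rfl, hO, fun y hy ↦ ?_, fun i y hy ↦ ?_, fun i y hy ↦ ?_⟩
  · have h := S.inner_bracket_ξ (hsm 0) (hsm 1) hU (fun z hz ↦ hinner z hz 2 0)
      (fun z hz ↦ hinner z hz 2 1) hy
    refine h.trans ?_
    -- Since `e 1 = φ X`, this is φ² X = -X; it produces the value +2.
    have h1 : S.φ y (e 1 y) = - e 0 y := by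
      have := S.φ_sq y (X y)
      rw [S.η_eq, (hXy y hy).2, zero_smul, add_zero] at this
      exact this
    rw [h1, map_neg, hinner y hy 0 0]
    norm_num
  · have h := S.inner_bracket_ξ (hsm 2) (hsm i) hU (fun z hz ↦ hinner z hz 2 2)
      (fun z hz ↦ hinner z hz 2 i) hy
    refine h.trans ?_
    have := S.inner_ξ_φ y (e i y)
    change -2 * S.g.inner y (S.ξ y) (S.φ y (e i y)) = 0
    rw [this, mul_zero]
  · rw [hαβ.2.2 y (e i y), S.η_eq]
    rfl

/-- The sum `α + β` is constant. -/
theorem add_eq_const [ConnectedSpace M] {α β : M → ℝ} (hαβ : S.IsGeneralizedEtaEinsteinWith α β)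
    (x y : M) : α x + β x = α y + β y := by
  have hd : MDifferentiable (𝓡 3) 𝓘(ℝ) (fun x ↦ α x + β x) :=
    (hαβ.1.add hαβ.2.1).mdifferentiable (by simp)
  have : IsManifold (𝓡 3) 1 M := IsManifold.of_le (n := ∞) ENat.LEInfty.out
  refine (isLocallyConstant_of_mfderiv_eq_zero hd fun z ↦ ?_).apply_eq_of_preconnectedSpace x y
  obtain ⟨U, e, hz, -, he⟩ := S.exists_frame hαβ z
  refine ContinuousLinearMap.ext fun v ↦ ?_
  have h : ∀ i, mfderiv (𝓡 3) 𝓘(ℝ) (fun x ↦ α x + β x) z (e i z) = (0 : ℝ) :=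
    fun i ↦ he.dirDeriv_add_eq_zero hz i
  rw [← he.sum_inner_smul z hz v, map_sum]
  refine Finset.sum_eq_zero fun i _ ↦ ?_
  rw [map_smul, h i]
  exact smul_zero (A := ℝ) _

end ContactMetricStructure

end

/-! ### The two cases α + β = 2 and α + β ≠ 2 -/

theorem mainTheorem2 (M : Type*) [TopologicalSpace M] [T2Space M] [SecondCountableTopology M]
    [ConnectedSpace M] [ChartedSpace (EuclideanSpace ℝ (Fin 3)) M] [IsManifold (𝓡 3) ∞ M]
    (S : ContactMetricStructure M) (hS : S.IsStrictGeneralizedEtaEinstein) :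
    S.IsKContact := by
  obtain ⟨α, β, hαβ, hconst⟩ := hS
  have hκ := S.add_eq_const hαβ
  by_cases h2 : ∃ x, α x + β x = 2
  · obtain ⟨x₀, h₀⟩ := h2
    intro X Y hX hY x
    obtain ⟨U, e, hx, he2, he⟩ := S.exists_frame hαβ x
    have sX : SmoothFieldOn U X := fun y _ ↦ hX y
    have sY : SmoothFieldOn U Y := fun y _ ↦ hY y
    have sξ : SmoothFieldOn U S.ξ := S.smoothFieldOn_ξ
    have hskew := he.covDeriv_skew hx (by rw [hκ x x₀, h₀]) (X x) (Y x)
    have h := dirDeriv_inner (g := S.g) sξ sX sY hx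
    -- With [ξ, X] = ∇_ξ X - ∇_X ξ, the Killing equation reduces to the skewness of ∇ξ.
    rw [← covDeriv_sub_covDeriv (g := S.g) sξ sX hx, ← covDeriv_sub_covDeriv (g := S.g) sξ sY hx]
    rw [he2] at hskew
    simp only [map_sub, _root_.sub_apply, covDeriv] at h ⊢
    refine Eq.trans h ?_
    linarith
  · push Not at h2
    have hα : ∀ x, α x = 0 := fun x ↦ by
      obtain ⟨U, e, hx, -, he⟩ := S.exists_frame hαβ x
      exact he.eq_zero_of_add_ne_two (fun y _ ↦ h2 y) hx
    obtain ⟨x₀⟩ := (inferInstance : Nonempty M)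
    refine absurd ⟨⟨0, hα⟩, β x₀, fun x ↦ ?_⟩ hconst
    have := hκ x x₀
    rwa [hα, hα, zero_add, zero_add] at this
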